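/- (Generalized Noiseless Source Coding Theorem.) All logarithms are binary. Let $\mathcal X,\mathcal Y$ be standard Borel (e.g. Polish) spaces, let $(X,Y)\sim P_{X,Y}$ take values in $\mathcal X\times\mathcal Y$, and let $P_{Y\mid X}$ be a Markov kernel that is a version of the conditional law of $Y$ given $X$. Assume there is a constant $M$ such that for every $x\in\mathcal X$ one has $P_{Y\mid X=x}\ll P_Y$ and $\frac{dP_{Y\mid X=x}}{dP_Y}(y)\le M$ for $P_Y$-almost every $y$. For $y\in\mathcal Y$ and $\ell>0$ let $w_y(\ell)=P_X\big(\big\{x:\frac{dP_{X\mid Y=y}}{dP_X}(x)\ge \ell\big\}\big)$, and define the functional information $$I_{\mathrm F}(X;Y)=\mathbb E_{y\sim P_Y}\left[-\int_0^\infty w_y(\ell)\log w_y(\ell)\,d\ell\right].$$ For a random variable $Z$ let $H(Y\mid Z)=\mathbb E_{z\sim P_Z}\big[H(P_{Y\mid Z=z})\big]\in[0,\infty]$, where $H(P)=\mathbb E_{Y\sim P}[-\log P(\{Y\})]$ is the Shannon entropy (equal to $\infty$ if $P$ is not discrete). Let $$H^*=\inf_{Z\perp X}H(Y\mid Z),$$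 the infimum being over all random variables $Z$ with values in a standard Borel space, jointly distributed with $(X,Y)\sim P_{X,Y}$, that are independent of $X$. A relative entropy code for $P_{Y\mid X}$ consists of a random variable $Z$ (the common randomness) with values in a standard Borel space $\mathcal Z$ and independent of $X$, a measurable encoder $\mathrm{enc}:\mathcal X\times\mathcal Z\to\{0,1\}^*$ and a measurable decoder $\mathrm{dec}:\{0,1\}^*\times\mathcal Z\to\mathcal Y$ such that $\mathrm{dec}(\mathrm{enc}(x,Z),Z)\sim P_{Y\mid X=x}$ for every $x\in\mathcal X$; its rate is $H(Y\mid Z)$ with $Y=\mathrm{dec}(\mathrm{enc}(X,Z),Z)$. Let $H^*_{\mathrm{code}}$ be the infimum of the rates of all relative entropy codes. Then $$I_{\mathrm F}(X;Y)\;\le\; H^*\;\le\; H^*_{\mathrm{code}}\;\le\; I_{\mathrm F}(X;Y)+\log e .$$ In particular $I_{\mathrm F}(X;Y)\le H^*\le I_{\mathrm F}(X;Y)+\log e$, and the same holds for $H^*_{\mathrm{code}}$. -/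

import Mathlib

open MeasureTheory ProbabilityTheory
open scoped ENNReal NNReal

universe u v w

noncomputable section

/-- The surprisal `-log₂ p` of a probability `p`, in bits, with `-log₂ 0 = ∞`. -/
def surprisal (p : ℝ≥0∞) : ℝ≥0∞ :=
  if p = 0 then ∞ else ENNReal.ofReal (-Real.logb 2 p.toReal)

/-- Shannon entropy `H(P) = E_{Y ∼ P}[-log₂ P({Y})]`, in bits, of a probability measure. If `P` is
discrete this is `-∑ P({y}) log₂ P({y})`; if `P` is not discrete, the set of points of mass zero has
positive probability and the value is `∞`. -/
def entropy {𝒴 : Type v} [MeasurableSpace 𝒴] (P : Measure 𝒴) : ℝ≥0∞ :=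
  ∫⁻ y, surprisal (P {y}) ∂P

/-- Conditional entropy `H(Y | Z) = E_{z ∼ P_Z}[H(P_{Y | Z = z})]`, in bits. -/
def condEntropy {Ω : Type u} {𝒴 : Type v} {𝒵 : Type w} [MeasurableSpace Ω]
    [MeasurableSpace 𝒴] [StandardBorelSpace 𝒴] [Nonempty 𝒴] [MeasurableSpace 𝒵]
    (Y : Ω → 𝒴) (Z : Ω → 𝒵) (μ : Measure Ω) [IsFiniteMeasure μ] : ℝ≥0∞ :=
  ∫⁻ z, entropy (condDistrib Y Z μ z) ∂(μ.map Z)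

/-- The width function `w_Q(ℓ) = Q(dP/dQ ≥ ℓ)` (for `P ≪ Q`). -/
def width {𝒳 : Type u} [MeasurableSpace 𝒳] (P Q : Measure 𝒳) (ℓ : ℝ) : ℝ :=
  Q.real {x | ENNReal.ofReal ℓ ≤ P.rnDeriv Q x}

/-- The channel simulation divergence `D_CS(P ‖ Q) = -∫_0^∞ w_Q(ℓ) log₂ w_Q(ℓ) dℓ`, in bits, for
probability measures `P ≪ Q`. The integrand is nonnegative because `0 ≤ w_Q ≤ 1`. -/
def channelSimDiv {𝒳 : Type u} [MeasurableSpace 𝒳] (P Q : Measure 𝒳) : ℝ≥0∞ :=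
  ∫⁻ ℓ in Set.Ioi (0 : ℝ), ENNReal.ofReal (-(width P Q ℓ * Real.logb 2 (width P Q ℓ)))

/-- The functional information `I_F(X; Y) = E_{y ∼ P_Y}[D_CS(P_{X | Y = y} ‖ P_X)]` of a pair
`(X, Y)` with joint law `P`, where `P_X = P.fst` and `P_Y = P.snd`. -/
def functionalInformation {𝒳 : Type u} {𝒴 : Type v} [MeasurableSpace 𝒳] [StandardBorelSpace 𝒳]
    [Nonempty 𝒳] [MeasurableSpace 𝒴] (P : Measure (𝒳 × 𝒴)) [IsFiniteMeasure P] : ℝ≥0∞ :=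
  ∫⁻ y, channelSimDiv (condDistrib Prod.fst Prod.snd P y) P.fst ∂P.snd

/-- A joint law `μ` of `(X, Y, Z)` in which `(X, Y)` has law `P` and `Z` is independent of `X`. -/
structure IsCommonRandomness {𝒳 : Type u} {𝒴 : Type v} {𝒵 : Type w} [MeasurableSpace 𝒳]
    [MeasurableSpace 𝒴] [MeasurableSpace 𝒵] (P : Measure (𝒳 × 𝒴)) (μ : Measure (𝒳 × 𝒴 × 𝒵)) :
    Prop where
  map_eq : μ.map (fun t => (t.1, t.2.1)) = P
  indep : IndepFun (fun t => t.1) (fun t => t.2.2) μ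

/-- `H* = inf_{Z ⊥ X} H(Y | Z)`: the infimum is over all random variables `Z` with values in a
standard Borel space that are jointly distributed with `(X, Y) ∼ P` and independent of `X`. -/
def minRate {𝒳 : Type u} {𝒴 : Type v} [MeasurableSpace 𝒳]
    [MeasurableSpace 𝒴] [StandardBorelSpace 𝒴] [Nonempty 𝒴] (P : Measure (𝒳 × 𝒴)) : ℝ≥0∞ :=
  sInf {h | ∃ (𝒵 : Type w) (_ : MeasurableSpace 𝒵) (_ : StandardBorelSpace 𝒵)
    (μ : Measure (𝒳 × 𝒴 × 𝒵)) (_ : IsProbabilityMeasure μ),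
    IsCommonRandomness P μ ∧ h = condEntropy (fun t => t.2.1) (fun t => t.2.2) μ}

/-- A stochastic code (relative entropy code) for the channel `W`: a law for the common randomness
`Z`, an encoder `enc : 𝒳 × 𝒵 → {0,1}*` and a decoder `dec : {0,1}* × 𝒵 → 𝒴`, both measurable (with
the discrete σ-algebra on strings), such that `dec (enc (x, Z), Z) ∼ W x` for every input `x`. -/
structure StochasticCode {𝒳 : Type u} {𝒴 : Type v} [MeasurableSpace 𝒳] [MeasurableSpace 𝒴]
    (W : Kernel 𝒳 𝒴) (𝒵 : Type w) [MeasurableSpace 𝒵] where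
  law : Measure 𝒵
  isProbabilityMeasure_law : IsProbabilityMeasure law
  enc : 𝒳 → 𝒵 → List Bool
  dec : List Bool → 𝒵 → 𝒴
  measurableSet_enc : ∀ s, MeasurableSet {p : 𝒳 × 𝒵 | enc p.1 p.2 = s}
  measurable_dec : ∀ s, Measurable (dec s)
  map_eq : ∀ x, law.map (fun z => dec (enc x z) z) = W x

attribute [instance] StochasticCode.isProbabilityMeasure_law

/-- The rate `H(Y | Z)` of a stochastic code on an input `X ∼ P_X` independent of the common
randomness `Z`, where `Y = dec (enc (X, Z), Z)`. -/
def StochasticCode.rate {𝒳 : Type u} {𝒴 : Type v} {𝒵 : Type w} [MeasurableSpace 𝒳]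
    [MeasurableSpace 𝒴] [StandardBorelSpace 𝒴] [Nonempty 𝒴] [MeasurableSpace 𝒵]
    {W : Kernel 𝒳 𝒴} (C : StochasticCode W 𝒵) (PX : Measure 𝒳) [IsProbabilityMeasure PX] : ℝ≥0∞ :=
  condEntropy (fun p : 𝒳 × 𝒵 => C.dec (C.enc p.1 p.2) p.2) Prod.snd (PX.prod C.law)

/-- The minimum rate over all stochastic codes for the channel `W` with input law `PX` and common
randomness in a standard Borel space. -/
def minCodeRate {𝒳 : Type u} {𝒴 : Type v} [MeasurableSpace 𝒳]
    [MeasurableSpace 𝒴] [StandardBorelSpace 𝒴] [Nonempty 𝒴]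
    (PX : Measure 𝒳) [IsProbabilityMeasure PX] (W : Kernel 𝒳 𝒴) : ℝ≥0∞ :=
  sInf {h | ∃ (𝒵 : Type w) (_ : MeasurableSpace 𝒵) (_ : StandardBorelSpace 𝒵)
    (C : StochasticCode W 𝒵), h = C.rate PX}

end

/-!
Lower bound. For `0 < p ≤ 1` one has `p (log e - log p) = log e ∫₀¹ min(t, p) / t dt` and
`log e - log p = log e ∫₀¹ min(1, t / p) / t dt`. Applied to `p = w_Y(ℓ)` and to
`p = P_{Y|Z}({Y})`, these reduce `I_F(X; Y) ≤ H(Y | Z)` to the inequality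
`E ∫ min(t, w_Y(ℓ)) dℓ ≤ E min(1, t / P_{Y|Z}({Y}))` for each `t`. Where `P_{Y|Z}({Y}) ≥ t`, the
independence of `X` and `Z` bounds the law of `(X, Y)` by `P_X × m`, with `m` the law of `Y`
weighted by `1 / P_{Y|Z}({Y})`; cutting the width function at the level `dm/dP_Y` gives the claim.

Upper bound. Rejection sampling with proposals uniform under a bounding level of the density
`dP_{Y|X=x}/dP_Y` produces `Y` from the index `K` of the first accepted proposal, so that
`H(Y | Z) ≤ H(K | Z)`. Gibbs' inequality compares the law of `K` given `Z` with the weights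
obtained by multiplying the acceptance probability of the `k`-th proposal by a geometric factor:
the acceptance probabilities contribute at most `I_F(X; Y)` and the geometric factors at most
`log e`.
-/

/-- `log₂ e`, the conversion factor from nats to bits. -/
noncomputable def bitsPerNat : ℝ≥0∞ :=
  ENNReal.ofReal (Real.logb 2 (Real.exp 1))

section Surprisal

theorem bitsPerNat_ne_top : bitsPerNat ≠ ∞ :=
  ENNReal.ofReal_ne_top

theorem bitsPerNat_mul_ofReal (a : ℝ) :
    bitsPerNat * ENNReal.ofReal a = ENNReal.ofReal (a / Real.log 2) := by
  rw [bitsPerNat, ← ENNReal.ofReal_mul (Real.logb_nonneg one_lt_two (Real.one_le_exp zero_le_one)),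
    Real.logb, Real.log_exp, one_div_mul_eq_div]

theorem surprisal_eq_bitsPerNat_mul {p : ℝ≥0∞} (hp : p ≠ 0) :
    surprisal p = bitsPerNat * ENNReal.ofReal (-Real.log p.toReal) := by
  rw [surprisal, if_neg hp, bitsPerNat_mul_ofReal, Real.logb, neg_div]

@[simp]
theorem surprisal_zero : surprisal 0 = ∞ :=
  if_pos rfl

@[simp]
theorem surprisal_one : surprisal 1 = 0 := by
  simp [surprisal]

theorem measurable_surprisal : Measurable surprisal :=
  Measurable.ite (measurableSet_singleton 0) measurable_const <| by
    unfold Real.logb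
    fun_prop

theorem antitoneOn_surprisal : AntitoneOn surprisal (Set.Iic 1) := by
  intro p _ q hq hpq
  rcases eq_or_ne p 0 with rfl | hp
  · simp
  have hq_top : q ≠ ∞ := ne_top_of_le_ne_top ENNReal.one_ne_top hq
  rw [surprisal_eq_bitsPerNat_mul hp,
    surprisal_eq_bitsPerNat_mul (pos_of_ne_zero hp |>.trans_le hpq).ne']
  have hp_pos := ENNReal.toReal_pos hp (ne_top_of_le_ne_top hq_top hpq)
  gcongr

theorem surprisal_mul {p q : ℝ≥0∞} (hp : p ≤ 1) (hq : q ≤ 1) :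
    surprisal (p * q) = surprisal p + surprisal q := by
  rcases eq_or_ne p 0 with rfl | hp0
  · simp
  rcases eq_or_ne q 0 with rfl | hq0
  · simp
  have log_nonpos {a : ℝ≥0∞} (ha : a ≤ 1) : Real.log a.toReal ≤ 0 :=
    Real.log_nonpos ENNReal.toReal_nonneg (ENNReal.toReal_le_of_le_ofReal zero_le_one (by simpa))
  have toReal_ne_zero {a : ℝ≥0∞} (ha : a ≤ 1) (ha0 : a ≠ 0) : a.toReal ≠ 0 :=
    (ENNReal.toReal_pos ha0 (ne_top_of_le_ne_top ENNReal.one_ne_top ha)).ne'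
  rw [surprisal_eq_bitsPerNat_mul hp0, surprisal_eq_bitsPerNat_mul hq0,
    surprisal_eq_bitsPerNat_mul (mul_ne_zero hp0 hq0), ← mul_add, ENNReal.toReal_mul,
    Real.log_mul (toReal_ne_zero hp hp0) (toReal_ne_zero hq hq0), neg_add,
    ENNReal.ofReal_add (neg_nonneg.2 (log_nonpos hp)) (neg_nonneg.2 (log_nonpos hq))]

theorem surprisal_pow {p : ℝ≥0∞} (hp : p ≤ 1) (k : ℕ) :
    surprisal (p ^ k) = k * surprisal p := by
  induction k with
  | zero => simp
  | succ k ih =>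
    rw [pow_succ, surprisal_mul (pow_le_one₀ zero_le hp) hp, ih, Nat.cast_succ, add_one_mul]

theorem ofReal_neg_mul_logb_toReal {p : ℝ≥0∞} (hp : p ≠ ∞) :
    ENNReal.ofReal (-(p.toReal * Real.logb 2 p.toReal)) = p * surprisal p := by
  rcases eq_or_ne p 0 with rfl | hp0
  · simp
  rw [surprisal, if_neg hp0, ← mul_neg, ENNReal.ofReal_mul ENNReal.toReal_nonneg,
    ENNReal.ofReal_toReal hp]

theorem mul_surprisal_add_le {p q : ℝ≥0∞} (hp : p ≤ 1) (hq : q ≤ 1) :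
    p * surprisal p + bitsPerNat * p ≤ p * surprisal q + bitsPerNat * q := by
  rcases eq_or_ne p 0 with rfl | hp0
  · simp
  rcases eq_or_ne q 0 with rfl | hq0
  · simp [hp0]
  lift p to ℝ≥0 using ne_top_of_le_ne_top ENNReal.one_ne_top hp
  lift q to ℝ≥0 using ne_top_of_le_ne_top ENNReal.one_ne_top hq
  have hp' : (0 : ℝ) < p := by simpa [pos_iff_ne_zero] using hp0
  have hq' : (0 : ℝ) < q := by simpa [pos_iff_ne_zero] using hq0
  have log_p_nonpos : Real.log p ≤ 0 := Real.log_nonpos hp'.le (by exact_mod_cast hp)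
  have log_q_nonpos : Real.log q ≤ 0 := Real.log_nonpos hq'.le (by exact_mod_cast hq)
  have gibbs : (p : ℝ) * -Real.log p + p ≤ p * -Real.log q + q := by
    have log_div_le := Real.log_le_sub_one_of_pos (div_pos hq' hp')
    rw [Real.log_div hq'.ne' hp'.ne', le_sub_iff_add_le, le_div_iff₀ hp'] at log_div_le
    linarith
  calc (p : ℝ≥0∞) * surprisal p + bitsPerNat * p
      = bitsPerNat * ENNReal.ofReal (p * -Real.log p + p) := by
        rw [surprisal_eq_bitsPerNat_mul hp0, ENNReal.coe_toReal,
          ENNReal.ofReal_add (mul_nonneg hp'.le (neg_nonneg.2 log_p_nonpos)) hp'.le,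
          ENNReal.ofReal_mul hp'.le, ENNReal.ofReal_coe_nnreal]
        ring
    _ ≤ bitsPerNat * ENNReal.ofReal (p * -Real.log q + q) := by gcongr
    _ = p * surprisal q + bitsPerNat * q := by
        rw [surprisal_eq_bitsPerNat_mul hq0, ENNReal.coe_toReal,
          ENNReal.ofReal_add (mul_nonneg hp'.le (neg_nonneg.2 log_q_nonpos)) hq'.le,
          ENNReal.ofReal_mul hp'.le, ENNReal.ofReal_coe_nnreal, ENNReal.ofReal_coe_nnreal]
        ring

theorem lintegral_Ioc_ofReal_inv {q : ℝ} (hq : 0 < q) (hq1 : q ≤ 1) :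
    ∫⁻ t in Set.Ioc q 1, ENNReal.ofReal t⁻¹ = ENNReal.ofReal (-Real.log q) := by
  have h_int : IntegrableOn (fun t : ℝ => t⁻¹) (Set.Ioc q 1) := by
    rw [← intervalIntegrable_iff_integrableOn_Ioc_of_le hq1, intervalIntegrable_inv_iff]
    simp [Set.uIcc_of_le hq1, hq]
  have h_nonneg : 0 ≤ᵐ[volume.restrict (Set.Ioc q 1)] fun t : ℝ => t⁻¹ := by
    filter_upwards [self_mem_ae_restrict measurableSet_Ioc] with t ht
    exact inv_nonneg.2 (hq.trans ht.1).le
  rw [← ofReal_integral_eq_lintegral_ofReal h_int h_nonneg, ← intervalIntegral.integral_of_le hq1,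
    integral_inv_of_pos hq one_pos, one_div, Real.log_inv]

theorem lintegral_min_ofReal_div {p : ℝ≥0∞} (hp0 : p ≠ 0) (hp : p ≤ 1) :
    ∫⁻ t in Set.Ioo (0 : ℝ) 1, min (ENNReal.ofReal t) p / ENNReal.ofReal t =
      p * (1 + ENNReal.ofReal (-Real.log p.toReal)) := by
  lift p to ℝ≥0 using ne_top_of_le_ne_top ENNReal.one_ne_top hp
  have hp_pos : (0 : ℝ) < p := by simpa [pos_iff_ne_zero] using hp0
  have hp_le : (p : ℝ) ≤ 1 := by exact_mod_cast hp
  have below : ∫⁻ t in Set.Ioc (0 : ℝ) p, min (ENNReal.ofReal t) p / ENNReal.ofReal t = p := by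
    rw [setLIntegral_congr_fun (g := 1) measurableSet_Ioc]
    · simp
    · intro t ht
      simp only [min_eq_left (ENNReal.ofReal_le_of_le_toReal (b := (p : ℝ≥0∞)) ht.2), Pi.one_apply]
      exact ENNReal.div_self (by simpa using ht.1) ENNReal.ofReal_ne_top
  have above : ∫⁻ t in Set.Ioc (p : ℝ) 1, min (ENNReal.ofReal t) p / ENNReal.ofReal t =
      p * ENNReal.ofReal (-Real.log p) := by
    rw [← lintegral_Ioc_ofReal_inv hp_pos hp_le, ← lintegral_const_mul _ (by fun_prop)]
    refine setLIntegral_congr_fun measurableSet_Ioc fun t ht => ?_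
    simp only [min_eq_right ((ENNReal.le_ofReal_iff_toReal_le ENNReal.coe_ne_top
      (hp_pos.trans ht.1).le).2 ht.1.le)]
    rw [div_eq_mul_inv, ENNReal.ofReal_inv_of_pos (hp_pos.trans ht.1)]
  rw [restrict_Ioo_eq_restrict_Ioc, ← Set.Ioc_union_Ioc_eq_Ioc hp_pos.le hp_le,
    lintegral_union measurableSet_Ioc (Set.Ioc_disjoint_Ioc_of_le le_rfl), below, above, mul_add,
    mul_one, ENNReal.coe_toReal]

theorem bitsPerNat_mul_lintegral_min_ofReal_div {p : ℝ≥0∞} (hp : p ≤ 1) :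
    bitsPerNat * ∫⁻ t in Set.Ioo (0 : ℝ) 1, min (ENNReal.ofReal t) p / ENNReal.ofReal t =
      p * (bitsPerNat + surprisal p) := by
  rcases eq_or_ne p 0 with rfl | hp0
  · simp
  · rw [lintegral_min_ofReal_div hp0 hp, surprisal_eq_bitsPerNat_mul hp0]
    ring

theorem bitsPerNat_mul_lintegral_min_one_div_of_ne_zero {p : ℝ≥0∞} (hp0 : p ≠ 0) (hp : p ≤ 1) :
    bitsPerNat * ∫⁻ t in Set.Ioo (0 : ℝ) 1, min 1 (ENNReal.ofReal t / p) / ENNReal.ofReal t =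
      bitsPerNat + surprisal p := by
  have hp_top : p ≠ ∞ := ne_top_of_le_ne_top ENNReal.one_ne_top hp
  rw [← ENNReal.mul_right_inj hp0 hp_top, ← bitsPerNat_mul_lintegral_min_ofReal_div hp,
    mul_left_comm, ← lintegral_const_mul _ (by fun_prop)]
  congr 2 with t
  rw [← mul_div_assoc, mul_min, mul_one, ENNReal.mul_div_cancel hp0 hp_top, min_comm]

theorem bitsPerNat_mul_lintegral_min_one_div {p : ℝ≥0∞} (hp : p ≤ 1) :
    bitsPerNat * ∫⁻ t in Set.Ioo (0 : ℝ) 1, min 1 (ENNReal.ofReal t / p) / ENNReal.ofReal t =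
      bitsPerNat + surprisal p := by
  rcases eq_or_ne p 0 with rfl | hp0
  swap
  · exact bitsPerNat_mul_lintegral_min_one_div_of_ne_zero hp0 hp
  rw [surprisal_zero, add_top]
  refine ENNReal.eq_top_of_forall_nnreal_le fun a => ?_
  have h_pos : (2 : ℝ≥0∞)⁻¹ ^ ⌈a⌉₊ ≠ 0 := by simp
  have h_le : (2 : ℝ≥0∞)⁻¹ ^ ⌈a⌉₊ ≤ 1 := pow_le_one₀ zero_le (by simp)
  have surprisal_half : surprisal 2⁻¹ = 1 := by simp [surprisal, Real.logb_inv]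
  calc (a : ℝ≥0∞) ≤ surprisal (2⁻¹ ^ ⌈a⌉₊) := by
        rw [surprisal_pow (by simp), surprisal_half, mul_one]
        exact_mod_cast Nat.le_ceil a
    _ ≤ _ := le_add_self
    _ = _ := (bitsPerNat_mul_lintegral_min_one_div_of_ne_zero h_pos h_le).symm
    _ ≤ _ := by
        gcongr
        exact zero_le

theorem tsum_natCast_mul_pow {q : ℝ≥0∞} (hq : q < 1) :
    ∑' k : ℕ, k * q ^ k = q / (1 - q) ^ 2 := by
  lift q to ℝ≥0 using hq.ne_top
  have hq' : ‖(q : ℝ)‖ < 1 := by simpa using hq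
  have h_sum := hasSum_coe_mul_geometric_of_norm_lt_one hq'
  have h_sub : 0 < 1 - (q : ℝ) := by simpa using hq
  calc ∑' k : ℕ, (k : ℝ≥0∞) * q ^ k = ∑' k : ℕ, ENNReal.ofReal (k * (q : ℝ) ^ k) := by
        congr with k
        rw [ENNReal.ofReal_mul k.cast_nonneg, ENNReal.ofReal_natCast,
          ENNReal.ofReal_pow q.coe_nonneg, ENNReal.ofReal_coe_nnreal]
    _ = ENNReal.ofReal (q / (1 - q) ^ 2) := by
        rw [← h_sum.tsum_eq, ENNReal.ofReal_tsum_of_nonneg (fun k => by positivity) h_sum.summable]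
    _ = q / (1 - q) ^ 2 := by
        rw [ENNReal.ofReal_div_of_pos (by positivity), ENNReal.ofReal_pow h_sub.le,
          ENNReal.ofReal_sub _ q.coe_nonneg, ENNReal.ofReal_one, ENNReal.ofReal_coe_nnreal]

theorem tsum_geometric_mul_surprisal_le {q : ℝ≥0∞} (hq : q < 1) :
    (1 - q) * ∑' k : ℕ, q ^ k * surprisal (q ^ k) ≤ bitsPerNat := by
  have h_sub0 : 1 - q ≠ 0 := (tsub_pos_of_lt hq).ne'
  have h_sub_top : 1 - q ≠ ∞ := ENNReal.sub_ne_top ENNReal.one_ne_top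
  have gibbs : q * surprisal q ≤ bitsPerNat * (1 - q) := by
    rw [ENNReal.mul_sub fun _ _ => bitsPerNat_ne_top, mul_one]
    refine ENNReal.le_sub_of_add_le_right (ENNReal.mul_ne_top bitsPerNat_ne_top hq.ne_top) ?_
    simpa using mul_surprisal_add_le hq.le le_rfl
  calc (1 - q) * ∑' k : ℕ, q ^ k * surprisal (q ^ k)
      = (1 - q) * ((∑' k : ℕ, k * q ^ k) * surprisal q) := by
        rw [← ENNReal.tsum_mul_right]
        congr 2 with k
        rw [surprisal_pow hq.le]
        ring
    _ = q * surprisal q / (1 - q) := by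
        rw [tsum_natCast_mul_pow hq, pow_two, div_eq_mul_inv, div_eq_mul_inv,
          ENNReal.mul_inv (.inl h_sub0) (.inl h_sub_top)]
        calc _ = (1 - q) * (1 - q)⁻¹ * (q * surprisal q * (1 - q)⁻¹) := by ring
          _ = _ := by rw [ENNReal.mul_inv_cancel h_sub0 h_sub_top, one_mul]
    _ ≤ bitsPerNat := ENNReal.div_le_of_le_mul gibbs

end Surprisal

section LayerCake

variable {α β : Type*} [MeasurableSpace α] [MeasurableSpace β]

theorem lintegral_measure_prodMk_comm (μ : Measure α) (ν : Measure β) [SFinite μ] [SFinite ν]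
    {s : Set (α × β)} (hs : MeasurableSet s) :
    ∫⁻ a, ν {b | (a, b) ∈ s} ∂μ = ∫⁻ b, μ {a | (a, b) ∈ s} ∂ν :=
  (Measure.prod_apply hs).symm.trans (Measure.prod_apply_symm hs)

theorem lintegral_measure_prodMk_mul (μ : Measure α) (ν : Measure β) [SFinite μ] [SFinite ν]
    {s : Set (α × β)} (hs : MeasurableSet s) {f : β → ℝ≥0∞} (hf : Measurable f) :
    ∫⁻ b, μ {a | (a, b) ∈ s} * f b ∂ν = ∫⁻ a, (∫⁻ b in {b | (a, b) ∈ s}, f b ∂ν) ∂μ := by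
  calc ∫⁻ b, μ {a | (a, b) ∈ s} * f b ∂ν = ∫⁻ b, μ {a | (a, b) ∈ s} ∂(ν.withDensity f) :=
        (lintegral_congr fun b => mul_comm _ _).trans
          (lintegral_withDensity_eq_lintegral_mul ν hf (measurable_measure_prodMk_right hs)).symm
    _ = ∫⁻ a, ν.withDensity f {b | (a, b) ∈ s} ∂μ := (lintegral_measure_prodMk_comm μ _ hs).symm
    _ = ∫⁻ a, (∫⁻ b in {b | (a, b) ∈ s}, f b ∂ν) ∂μ :=
        lintegral_congr fun a => withDensity_apply f (measurable_prodMk_left hs)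

theorem volume_restrict_Ioi_ofReal_le (c : ℝ≥0∞) :
    volume.restrict (Set.Ioi (0 : ℝ)) {l | ENNReal.ofReal l ≤ c} = c := by
  rw [Measure.restrict_apply (measurableSet_le (by fun_prop) measurable_const)]
  rcases eq_or_ne c ∞ with rfl | hc
  · simp
  have : {l : ℝ | ENNReal.ofReal l ≤ c} ∩ Set.Ioi 0 = Set.Ioc 0 c.toReal := by
    ext l
    simp only [Set.mem_inter_iff, Set.mem_ofPred_eq, Set.mem_Ioi, Set.mem_Ioc,
      ENNReal.ofReal_le_iff_le_toReal hc, and_comm]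
  rw [this, Real.volume_Ioc, sub_zero, ENNReal.ofReal_toReal hc]

theorem volume_restrict_Ioi_ofReal_mem_Ioc (c d : ℝ≥0∞) :
    volume.restrict (Set.Ioi (0 : ℝ)) {l | ENNReal.ofReal l ∈ Set.Ioc c d} = d - c := by
  rcases eq_or_ne c ∞ with rfl | hc
  · simp
  have h_meas (b : ℝ≥0∞) : MeasurableSet {l : ℝ | ENNReal.ofReal l ≤ b} :=
    measurableSet_le (by fun_prop) measurable_const
  have h_diff : {l : ℝ | ENNReal.ofReal l ∈ Set.Ioc c d} =
      {l : ℝ | ENNReal.ofReal l ≤ max c d} \ {l : ℝ | ENNReal.ofReal l ≤ c} := by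
    ext l
    simp only [Set.mem_ofPred_eq, Set.mem_Ioc, Set.mem_sdiff, le_max_iff, not_le]
    exact ⟨fun h => ⟨.inr h.2, h.1⟩, fun h => ⟨h.2, h.1.resolve_left h.2.not_ge⟩⟩
  have h_sub : {l : ℝ | ENNReal.ofReal l ≤ c} ⊆ {l : ℝ | ENNReal.ofReal l ≤ max c d} :=
    fun l hl => show ENNReal.ofReal l ≤ max c d from le_max_of_le_left hl
  rw [h_diff, measure_sdiff h_sub (h_meas c).nullMeasurableSet
    (by rwa [volume_restrict_Ioi_ofReal_le]), volume_restrict_Ioi_ofReal_le,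
    volume_restrict_Ioi_ofReal_le]
  rcases le_total c d with h | h
  · rw [max_eq_right h]
  · rw [max_eq_left h, tsub_self, tsub_eq_zero_of_le h]

variable {ν : Measure α} [SFinite ν] {f : α → ℝ≥0∞}

theorem lintegral_measure_ofReal_le (hf : Measurable f) :
    ∫⁻ l in Set.Ioi (0 : ℝ), ν {a | ENNReal.ofReal l ≤ f a} = ∫⁻ a, f a ∂ν := by
  have hs : MeasurableSet {p : ℝ × α | ENNReal.ofReal p.1 ≤ f p.2} :=
    measurableSet_le (by fun_prop) (by fun_prop)
  refine (lintegral_measure_prodMk_comm _ ν hs).trans ?_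
  simp only [Set.mem_ofPred_eq, volume_restrict_Ioi_ofReal_le]

theorem lintegral_min_measure_ofReal_le (hf : Measurable f) (t c : ℝ≥0∞) :
    ∫⁻ l in Set.Ioi (0 : ℝ), min t (ν {a | ENNReal.ofReal l ≤ f a}) ≤
      t * c + ∫⁻ a, (f a - c) ∂ν := by
  have hs : MeasurableSet {p : ℝ × α | ENNReal.ofReal p.1 ∈ Set.Ioc c (f p.2)} :=
    (measurableSet_lt (g := fun p : ℝ × α => ENNReal.ofReal p.1) measurable_const
      (by fun_prop)).inter
      (measurableSet_le (f := fun p : ℝ × α => ENNReal.ofReal p.1) (g := fun p => f p.2)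
        (by fun_prop) (by fun_prop))
  have h_low : MeasurableSet {l : ℝ | ENNReal.ofReal l ≤ c} :=
    measurableSet_le (by fun_prop) measurable_const
  calc ∫⁻ l in Set.Ioi (0 : ℝ), min t (ν {a | ENNReal.ofReal l ≤ f a})
      ≤ ∫⁻ l in Set.Ioi (0 : ℝ), ({l : ℝ | ENNReal.ofReal l ≤ c}.indicator (fun _ => t) l +
          ν {a | ENNReal.ofReal l ∈ Set.Ioc c (f a)}) := by
        gcongr with l
        by_cases h : ENNReal.ofReal l ≤ c
        · rw [Set.indicator_of_mem (by exact h)]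
          exact (min_le_left _ _).trans le_self_add
        · rw [Set.indicator_of_notMem (by exact h), zero_add]
          exact (min_le_right _ _).trans (measure_mono fun a ha => ⟨not_le.1 h, ha⟩)
    _ = t * c + ∫⁻ a, (f a - c) ∂ν := by
        rw [lintegral_add_left (measurable_const.indicator h_low),
          lintegral_indicator_const h_low, volume_restrict_Ioi_ofReal_le]
        congr 1
        refine (lintegral_measure_prodMk_comm _ ν hs).trans ?_
        simp only [Set.mem_ofPred_eq, volume_restrict_Ioi_ofReal_mem_Ioc]

end LayerCake

section Density

variable {α β : Type*} [MeasurableSpace α] [MeasurableSpace β]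

theorem ae_eq_withDensity_of_compProd_eq [MeasurableSpace.CountableOrCountablyGenerated α β]
    {μ : Measure α} [IsFiniteMeasure μ] {ν : Measure β} [IsFiniteMeasure ν]
    {κ : Kernel α β} [IsFiniteKernel κ] {f : α → β → ℝ≥0∞} (hf : Measurable (Function.uncurry f))
    (h : μ ⊗ₘ κ = (μ.prod ν).withDensity (Function.uncurry f)) :
    ∀ᵐ a ∂μ, κ a = ν.withDensity (f a) := by
  have h_ac : ∀ᵐ a ∂μ, κ a ≪ ν := by
    have : μ ⊗ₘ κ ≪ μ ⊗ₘ Kernel.const α ν := by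
      rw [h, Measure.compProd_const]
      exact withDensity_absolutelyContinuous _ _
    exact this.kernel_of_compProd
  have h_rnDeriv : ∀ᵐ a ∂μ, κ a = ν.withDensity (κ.rnDeriv (Kernel.const α ν) a) := by
    filter_upwards [h_ac] with a ha
    nth_rw 1 [← Kernel.withDensity_rnDeriv_eq (η := Kernel.const α ν) ha,
      Kernel.withDensity_apply _ (Kernel.measurable_rnDeriv _ _), Kernel.const_apply]
  have h_joint : Function.uncurry (κ.rnDeriv (Kernel.const α ν)) =ᵐ[μ.prod ν]
      Function.uncurry f := by
    refine (withDensity_eq_iff_of_sigmaFinite (Kernel.measurable_rnDeriv _ _).aemeasurable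
      hf.aemeasurable).1 ?_
    rw [← h, ← Measure.compProd_const]
    refine (Measure.compProd_withDensity (Kernel.measurable_rnDeriv _ _)).symm.trans ?_
    refine Measure.compProd_congr ?_
    filter_upwards [h_ac] with a ha using Kernel.withDensity_rnDeriv_eq ha
  filter_upwards [h_rnDeriv, Measure.ae_ae_of_ae_prod h_joint] with a ha ha_eq
  exact ha.trans (withDensity_congr_ae ha_eq)

variable {𝒳 : Type u} {𝒴 : Type v} [MeasurableSpace 𝒳] [MeasurableSpace 𝒴]

theorem exists_bounded_density [MeasurableSpace.CountableOrCountablyGenerated 𝒳 𝒴]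
    {W : Kernel 𝒳 𝒴} [IsFiniteKernel W] {ν : Measure 𝒴} [IsFiniteMeasure ν] {b : ℝ≥0∞}
    (hW : ∀ x, W x ≪ ν ∧ ∀ᵐ y ∂ν, (W x).rnDeriv ν y ≤ b) :
    ∃ r : 𝒳 → 𝒴 → ℝ≥0∞, Measurable (Function.uncurry r) ∧ (∀ x y, r x y ≤ b) ∧
      ∀ x, W x = ν.withDensity (r x) := by
  refine ⟨fun x y => min (W.rnDeriv (Kernel.const 𝒳 ν) x y) b,
    (Kernel.measurable_rnDeriv W _).min measurable_const, fun x y => min_le_right _ _, fun x => ?_⟩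
  nth_rw 1 [← Measure.withDensity_rnDeriv_eq (W x) ν (hW x).1]
  refine withDensity_congr_ae ?_
  filter_upwards [(hW x).2, Kernel.rnDeriv_eq_rnDeriv_measure (κ := W) (η := Kernel.const 𝒳 ν)
    (a := x)] with y h_le h_eq
  rw [h_eq, Kernel.const_apply, min_eq_left h_le]

theorem compProd_eq_prod_withDensity {μ : Measure 𝒳} [SFinite μ] {ν : Measure 𝒴} [SFinite ν]
    {W : Kernel 𝒳 𝒴} [IsSFiniteKernel W] {r : 𝒳 → 𝒴 → ℝ≥0∞} (hr : Measurable (Function.uncurry r))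
    (hW : ∀ x, W x = ν.withDensity (r x)) :
    μ ⊗ₘ W = (μ.prod ν).withDensity (Function.uncurry r) := by
  have h_kernel : (Kernel.const 𝒳 ν).withDensity r = W := by
    ext1 x
    rw [Kernel.withDensity_apply _ hr, Kernel.const_apply, hW]
  have : IsSFiniteKernel ((Kernel.const 𝒳 ν).withDensity r) := by rwa [h_kernel]
  rw [← h_kernel, Measure.compProd_withDensity hr, Measure.compProd_const]
  rfl

theorem width_withDensity (Q : Measure 𝒳) [SigmaFinite Q] {f : 𝒳 → ℝ≥0∞} (hf : Measurable f)
    (l : ℝ) : width (Q.withDensity f) Q l = Q.real {x | ENNReal.ofReal l ≤ f x} := by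
  refine measureReal_congr ?_
  filter_upwards [Measure.rnDeriv_withDensity Q hf] with x hx
  exact congrArg (ENNReal.ofReal l ≤ ·) hx

variable [StandardBorelSpace 𝒳] [Nonempty 𝒳] {P : Measure (𝒳 × 𝒴)} {r : 𝒳 → 𝒴 → ℝ≥0∞}

theorem condDistrib_fst_snd_ae_eq_withDensity [IsFiniteMeasure P]
    (hr : Measurable (Function.uncurry r))
    (hP : P = (P.fst.prod P.snd).withDensity (Function.uncurry r)) :
    ∀ᵐ y ∂P.snd, condDistrib Prod.fst Prod.snd P y = P.fst.withDensity (fun x => r x y) := by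
  refine ae_eq_withDensity_of_compProd_eq (f := fun y x => r x y) (hr.comp measurable_swap) ?_
  calc P.snd ⊗ₘ condDistrib Prod.fst Prod.snd P = P.map Prod.swap :=
        compProd_map_condDistrib measurable_fst.aemeasurable
    _ = ((P.fst.prod P.snd).withDensity (Function.uncurry r)).map Prod.swap := by rw [← hP]
    _ = (P.snd.prod P.fst).withDensity (Function.uncurry fun y x => r x y) := by
        ext s hs
        rw [Measure.map_apply measurable_swap hs, withDensity_apply _ (measurable_swap hs),
          withDensity_apply _ hs, ← Measure.prod_swap,
          setLIntegral_map (measurable_swap hs) hr measurable_swap]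
        rfl

theorem lintegral_density_ae_eq_one [IsFiniteMeasure P] (hr : Measurable (Function.uncurry r))
    (hP : P = (P.fst.prod P.snd).withDensity (Function.uncurry r)) :
    ∀ᵐ y ∂P.snd, ∫⁻ x, r x y ∂P.fst = 1 := by
  filter_upwards [condDistrib_fst_snd_ae_eq_withDensity hr hP] with y hy
  rw [← setLIntegral_univ, ← withDensity_apply _ MeasurableSet.univ, ← hy, measure_univ]

theorem functionalInformation_eq_lintegral_width [IsFiniteMeasure P]
    (hr : Measurable (Function.uncurry r))
    (hP : P = (P.fst.prod P.snd).withDensity (Function.uncurry r)) :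
    functionalInformation P =
      ∫⁻ y, (∫⁻ l in Set.Ioi (0 : ℝ), P.fst {x | ENNReal.ofReal l ≤ r x y} *
        surprisal (P.fst {x | ENNReal.ofReal l ≤ r x y})) ∂P.snd := by
  refine lintegral_congr_ae ?_
  filter_upwards [condDistrib_fst_snd_ae_eq_withDensity hr hP] with y hy
  refine lintegral_congr fun l => ?_
  rw [hy, width_withDensity P.fst hr.of_uncurry_right l, measureReal_def,
    ofReal_neg_mul_logb_toReal (measure_ne_top _ _)]

end Density

section LowerBound

theorem lintegral_sub_le_of_withDensity_le_add {α : Type*} [MeasurableSpace α] {ν η : Measure α}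
    {f g : α → ℝ≥0∞} (hf : Measurable f) (hg : Measurable g) (hg_fin : ∫⁻ a, g a ∂ν ≠ ∞)
    (h : ν.withDensity f ≤ η + ν.withDensity g) : ∫⁻ a, (f a - g a) ∂ν ≤ η Set.univ := by
  have hs : MeasurableSet {a | g a < f a} := measurableSet_lt hg hf
  have hg_fin' : ∫⁻ a in {a | g a < f a}, g a ∂ν ≠ ∞ :=
    ne_top_of_le_ne_top hg_fin (setLIntegral_le_lintegral _ _)
  calc ∫⁻ a, (f a - g a) ∂ν = ∫⁻ a in {a | g a < f a}, (f a - g a) ∂ν := by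
        rw [← lintegral_indicator hs]
        congr with a
        by_cases ha : g a < f a
        · rw [Set.indicator_of_mem (by exact ha)]
        · rw [Set.indicator_of_notMem (by exact ha), tsub_eq_zero_of_le (not_lt.1 ha)]
    _ = ν.withDensity f {a | g a < f a} - ν.withDensity g {a | g a < f a} := by
        rw [lintegral_sub hg hg_fin' ((ae_restrict_mem hs).mono fun _ ha => le_of_lt ha),
          withDensity_apply _ hs, withDensity_apply _ hs]
    _ ≤ η {a | g a < f a} := tsub_le_iff_right.2 (h _)
    _ ≤ η Set.univ := measure_mono (Set.subset_univ _)

theorem min_one_div_eq_indicator_add (p t : ℝ≥0∞) :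
    min 1 (t / p) =
      (Set.Iio t).indicator 1 p + t * (Set.Ici t).indicator (fun p => p⁻¹) p := by
  rcases lt_or_ge p t with h | h
  · rw [Set.indicator_of_mem (by exact h), Set.indicator_of_notMem (by simpa using h), mul_zero,
      add_zero, Pi.one_apply, min_eq_left]
    rcases eq_or_ne p 0 with rfl | hp
    · simp [ENNReal.div_zero h.ne']
    · rw [ENNReal.le_div_iff_mul_le (.inl hp) (.inl h.ne_top), one_mul]
      exact h.le
  · rw [Set.indicator_of_notMem (by simpa using h), Set.indicator_of_mem (by exact h), zero_add,
      ← div_eq_mul_inv, min_eq_right]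
    exact ENNReal.div_le_of_le_mul (by rwa [one_mul])

theorem measurable_kernel_singleton {α β : Type*} [MeasurableSpace α] [MeasurableSpace β]
    [MeasurableEq β] (κ : Kernel α β) [IsSFiniteKernel κ] :
    Measurable fun q : α × β => κ q.1 {q.2} := by
  have hs : MeasurableSet {p : (α × β) × β | p.2 = p.1.2} :=
    measurableSet_eq_fun (by fun_prop) (by fun_prop)
  exact Kernel.measurable_kernel_prodMk_left (κ := κ.comap Prod.fst measurable_fst) hs

variable {𝒳 : Type u} {𝒴 : Type v} [MeasurableSpace 𝒳] [MeasurableSpace 𝒴]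
  {P : Measure (𝒳 × 𝒴)} {r : 𝒳 → 𝒴 → ℝ≥0∞}

theorem lintegral_min_width_le [IsFiniteMeasure P] (hr : Measurable (Function.uncurry r))
    (hP : P = (P.fst.prod P.snd).withDensity (Function.uncurry r)) {η : Measure (𝒳 × 𝒴)}
    {m : Measure 𝒴} [IsFiniteMeasure m] (hm : m ≪ P.snd) (h_le : P ≤ η + P.fst.prod m)
    (t : ℝ≥0∞) :
    ∫⁻ y, (∫⁻ l in Set.Ioi (0 : ℝ), min t (P.fst {x | ENNReal.ofReal l ≤ r x y})) ∂P.snd ≤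
      t * m Set.univ + η Set.univ := by
  set c : 𝒴 → ℝ≥0∞ := m.rnDeriv P.snd
  have hc : Measurable c := Measure.measurable_rnDeriv _ _
  have hm_eq : P.snd.withDensity c = m := Measure.withDensity_rnDeriv_eq m P.snd hm
  have prod_eq : P.fst.prod m = (P.fst.prod P.snd).withDensity fun a => c a.2 := by
    rw [← hm_eq, prod_withDensity_right hc]
  have hc_fin : ∫⁻ a, c a.2 ∂(P.fst.prod P.snd) ≠ ∞ := by
    rw [← setLIntegral_univ, ← withDensity_apply _ MeasurableSet.univ, ← prod_eq]
    exact measure_ne_top _ _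
  calc ∫⁻ y, (∫⁻ l in Set.Ioi (0 : ℝ), min t (P.fst {x | ENNReal.ofReal l ≤ r x y})) ∂P.snd
      ≤ ∫⁻ y, (t * c y + ∫⁻ x, (r x y - c y) ∂P.fst) ∂P.snd := by
        gcongr with y
        exact lintegral_min_measure_ofReal_le hr.of_uncurry_right t (c y)
    _ = t * m Set.univ + ∫⁻ a, (Function.uncurry r a - c a.2) ∂(P.fst.prod P.snd) := by
        rw [lintegral_add_left (by fun_prop), lintegral_const_mul _ hc, ← setLIntegral_univ c,
          ← withDensity_apply _ MeasurableSet.univ, hm_eq, lintegral_prod_symm _ (by fun_prop)]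
        rfl
    _ ≤ t * m Set.univ + η Set.univ := by
        gcongr
        refine lintegral_sub_le_of_withDensity_le_add hr (by fun_prop) hc_fin ?_
        rwa [← hP, ← prod_eq]

theorem bitsPerNat_add_functionalInformation_eq [StandardBorelSpace 𝒳] [Nonempty 𝒳]
    [IsProbabilityMeasure P] (hr : Measurable (Function.uncurry r))
    (hP : P = (P.fst.prod P.snd).withDensity (Function.uncurry r)) :
    bitsPerNat + functionalInformation P = bitsPerNat * ∫⁻ t in Set.Ioo (0 : ℝ) 1,
      (∫⁻ y, (∫⁻ l in Set.Ioi (0 : ℝ), min (ENNReal.ofReal t)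
        (P.fst {x | ENNReal.ofReal l ≤ r x y})) ∂P.snd) / ENNReal.ofReal t := by
  set w : 𝒴 × ℝ → ℝ≥0∞ := fun q => P.fst {x | ENNReal.ofReal q.2 ≤ r x q.1}
  have hw : Measurable w :=
    measurable_measure_prodMk_left (s := {a : (𝒴 × ℝ) × 𝒳 | ENNReal.ofReal a.1.2 ≤ r a.2 a.1.1})
      (measurableSet_le (by fun_prop) (by fun_prop))
  have hs : Measurable fun q => surprisal (w q) := measurable_surprisal.comp hw
  set τ : Measure (𝒴 × ℝ) := P.snd.prod (volume.restrict (Set.Ioi 0))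
  have lintegral_w : ∫⁻ q, w q ∂τ = 1 := by
    rw [lintegral_prod _ hw.aemeasurable, ← measure_univ (μ := P.snd), ← lintegral_one]
    refine lintegral_congr_ae ?_
    filter_upwards [lintegral_density_ae_eq_one hr hP] with y hy
    exact (lintegral_measure_ofReal_le hr.of_uncurry_right).trans hy
  have h_meas : Measurable fun a : (𝒴 × ℝ) × ℝ =>
      min (ENNReal.ofReal a.2) (w a.1) / ENNReal.ofReal a.2 := by fun_prop
  calc bitsPerNat + functionalInformation P
      = bitsPerNat * ∫⁻ q, w q ∂τ + ∫⁻ q, w q * surprisal (w q) ∂τ := by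
        rw [lintegral_w, mul_one, functionalInformation_eq_lintegral_width hr hP,
          lintegral_prod (fun q => w q * surprisal (w q)) (hw.mul hs).aemeasurable]
    _ = ∫⁻ q, w q * (bitsPerNat + surprisal (w q)) ∂τ := by
        rw [← lintegral_const_mul _ hw, ← lintegral_add_left (hw.const_mul _)]
        congr with q
        ring
    _ = bitsPerNat * ∫⁻ q, (∫⁻ t in Set.Ioo (0 : ℝ) 1,
          min (ENNReal.ofReal t) (w q) / ENNReal.ofReal t) ∂τ := by
        rw [← lintegral_const_mul' _ _ bitsPerNat_ne_top]
        congr with q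
        exact (bitsPerNat_mul_lintegral_min_ofReal_div prob_le_one).symm
    _ = bitsPerNat * ∫⁻ t in Set.Ioo (0 : ℝ) 1,
          (∫⁻ q, min (ENNReal.ofReal t) (w q) / ENNReal.ofReal t ∂τ) := by
        rw [lintegral_lintegral_swap h_meas.aemeasurable]
    _ = _ := by
        congr with t
        have h_min : Measurable fun q => min (ENNReal.ofReal t) (w q) := measurable_const.min hw
        simp only [div_eq_mul_inv]
        rw [lintegral_mul_const _ h_min, lintegral_prod _ h_min.aemeasurable]

end LowerBound

section CondMass

variable {Ω : Type*} {𝒳 : Type u} {𝒴 : Type v} {𝒵 : Type w} [MeasurableSpace Ω]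
  [MeasurableSpace 𝒳] [MeasurableSpace 𝒴] [StandardBorelSpace 𝒴] [Nonempty 𝒴] [MeasurableSpace 𝒵]

/-- The conditional probability `P_{Y | Z}({Y})` of the observed value of `Y`, as a random
variable. -/
noncomputable def condMass (Y : Ω → 𝒴) (Z : Ω → 𝒵) (μ : Measure Ω) [IsFiniteMeasure μ] (ω : Ω) :
    ℝ≥0∞ :=
  condDistrib Y Z μ (Z ω) {Y ω}

variable {P : Measure (𝒳 × 𝒴)} {r : 𝒳 → 𝒴 → ℝ≥0∞} {X : Ω → 𝒳} {Y : Ω → 𝒴} {Z : Ω → 𝒵}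
  {μ : Measure Ω} [IsFiniteMeasure μ]

theorem measurable_condMass (hY : Measurable Y) (hZ : Measurable Z) :
    Measurable (condMass Y Z μ) :=
  (measurable_kernel_singleton (condDistrib Y Z μ)).comp (hZ.prodMk hY)

theorem condEntropy_eq_lintegral_surprisal_condMass (hY : Measurable Y) (hZ : Measurable Z) :
    condEntropy Y Z μ = ∫⁻ ω, surprisal (condMass Y Z μ ω) ∂μ := by
  have h_meas : Measurable fun q : 𝒵 × 𝒴 => surprisal (condDistrib Y Z μ q.1 {q.2}) :=
    measurable_surprisal.comp (measurable_kernel_singleton _)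
  calc condEntropy Y Z μ
      = ∫⁻ q, surprisal (condDistrib Y Z μ q.1 {q.2}) ∂(μ.map Z ⊗ₘ condDistrib Y Z μ) :=
        (Measure.lintegral_compProd h_meas).symm
    _ = ∫⁻ ω, surprisal (condMass Y Z μ ω) ∂μ := by
        rw [compProd_map_condDistrib hY.aemeasurable, lintegral_map h_meas (hZ.prodMk hY)]
        rfl

theorem bitsPerNat_add_condEntropy_eq [IsProbabilityMeasure μ] (hY : Measurable Y)
    (hZ : Measurable Z) :
    bitsPerNat + condEntropy Y Z μ = bitsPerNat * ∫⁻ t in Set.Ioo (0 : ℝ) 1,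
      (∫⁻ ω, min 1 (ENNReal.ofReal t / condMass Y Z μ ω) ∂μ) / ENNReal.ofReal t := by
  have hp := measurable_condMass (μ := μ) hY hZ
  have h_meas : Measurable fun a : Ω × ℝ =>
      min 1 (ENNReal.ofReal a.2 / condMass Y Z μ a.1) / ENNReal.ofReal a.2 := by fun_prop
  calc bitsPerNat + condEntropy Y Z μ
      = ∫⁻ ω, (bitsPerNat + surprisal (condMass Y Z μ ω)) ∂μ := by
        rw [lintegral_add_left measurable_const, lintegral_const, measure_univ, mul_one,
          condEntropy_eq_lintegral_surprisal_condMass hY hZ]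
    _ = bitsPerNat * ∫⁻ ω, (∫⁻ t in Set.Ioo (0 : ℝ) 1,
          min 1 (ENNReal.ofReal t / condMass Y Z μ ω) / ENNReal.ofReal t) ∂μ := by
        rw [← lintegral_const_mul' _ _ bitsPerNat_ne_top]
        congr with ω
        exact (bitsPerNat_mul_lintegral_min_one_div prob_le_one).symm
    _ = bitsPerNat * ∫⁻ t in Set.Ioo (0 : ℝ) 1,
          (∫⁻ ω, min 1 (ENNReal.ofReal t / condMass Y Z μ ω) / ENNReal.ofReal t ∂μ) := by
        rw [lintegral_lintegral_swap h_meas.aemeasurable]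
    _ = _ := by
        congr with t
        simp only [div_eq_mul_inv]
        rw [lintegral_mul_const _ (by fun_prop)]

/-- `P_{Y | Z}({Y}) F(X, Z, Y)` is one term of the integral of `F(X, Z, ·)` against `P_{Y | Z}`, in
which `X` can be integrated out separately since it is independent of `Z`. -/
theorem lintegral_condMass_mul_le (hX : Measurable X) (hY : Measurable Y) (hZ : Measurable Z)
    (hXZ : IndepFun X Z μ) {F : 𝒳 × 𝒵 × 𝒴 → ℝ≥0∞} (hF : Measurable F) :
    ∫⁻ ω, condMass Y Z μ ω * F (X ω, Z ω, Y ω) ∂μ ≤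
      ∫⁻ ω, ∫⁻ x, F (x, Z ω, Y ω) ∂(μ.map X) ∂μ := by
  set κ : Kernel 𝒵 𝒴 := condDistrib Y Z μ with hκ
  have hF_int : Measurable fun q => ∫⁻ x, F (x, q) ∂(μ.map X) := hF.lintegral_prod_left'
  have hG : Measurable fun a : 𝒳 × 𝒵 => ∫⁻ y, F (a.1, a.2, y) ∂κ a.2 :=
    Measurable.lintegral_kernel_prod_right' (κ := κ.comap Prod.snd measurable_snd)
      (f := fun b : (𝒳 × 𝒵) × 𝒴 => F (b.1.1, b.1.2, b.2)) (by fun_prop)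
  calc ∫⁻ ω, condMass Y Z μ ω * F (X ω, Z ω, Y ω) ∂μ
      ≤ ∫⁻ ω, ∫⁻ y, F (X ω, Z ω, y) ∂κ (Z ω) ∂μ := by
        gcongr with ω
        rw [condMass, ← hκ, mul_comm, ← lintegral_singleton fun y => F (X ω, Z ω, y)]
        exact setLIntegral_le_lintegral _ _
    _ = ∫⁻ a, ∫⁻ y, F (a.1, a.2, y) ∂κ a.2 ∂((μ.map X).prod (μ.map Z)) := by
        rw [← (indepFun_iff_map_prod_eq_prod_map_map hX.aemeasurable hZ.aemeasurable).1 hXZ,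
          lintegral_map hG (hX.prodMk hZ)]
    _ = ∫⁻ z, ∫⁻ y, ∫⁻ x, F (x, z, y) ∂(μ.map X) ∂κ z ∂(μ.map Z) := by
        rw [lintegral_prod_symm _ hG.aemeasurable]
        congr with z
        exact lintegral_lintegral_swap (μ := μ.map X) (ν := κ z) (by fun_prop)
    _ = ∫⁻ ω, ∫⁻ x, F (x, Z ω, Y ω) ∂(μ.map X) ∂μ := by
        rw [← Measure.lintegral_compProd hF_int, compProd_map_condDistrib hY.aemeasurable,
          lintegral_map hF_int (hZ.prodMk hY)]

theorem measure_sdiff_condMass_lt_le (hX : Measurable X) (hY : Measurable Y) (hZ : Measurable Z)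
    (hXZ : IndepFun X Z μ) {t : ℝ≥0∞} (ht : t ≠ 0) {s : Set (𝒳 × 𝒴)} (hs : MeasurableSet s) :
    μ ((fun ω => (X ω, Y ω)) ⁻¹' s \ {ω | condMass Y Z μ ω < t}) ≤
      ∫⁻ ω, (Set.Ici t).indicator (·⁻¹) (condMass Y Z μ ω) * μ.map X {x | (x, Y ω) ∈ s} ∂μ := by
  set g : ℝ≥0∞ → ℝ≥0∞ := (Set.Ici t).indicator (·⁻¹)
  have hp := measurable_condMass (μ := μ) hY hZ
  have hg : Measurable g := measurable_inv.indicator measurableSet_Ici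
  have hgκ : Measurable fun q : 𝒵 × 𝒴 => g (condDistrib Y Z μ q.1 {q.2}) :=
    hg.comp (measurable_kernel_singleton _)
  have : Measurable (s.indicator (1 : 𝒳 × 𝒴 → ℝ≥0∞)) := measurable_one.indicator hs
  have h_event : MeasurableSet ((fun ω => (X ω, Y ω)) ⁻¹' s \ {ω | condMass Y Z μ ω < t}) :=
    (hX.prodMk hY hs).diff (measurableSet_lt hp measurable_const)
  calc μ ((fun ω => (X ω, Y ω)) ⁻¹' s \ {ω | condMass Y Z μ ω < t})
      = ∫⁻ ω, condMass Y Z μ ω *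
          (g (condMass Y Z μ ω) * s.indicator 1 (X ω, Y ω)) ∂μ := by
        rw [← lintegral_indicator_one h_event]
        congr with ω
        by_cases hω : condMass Y Z μ ω < t
        · simp [g, hω]
        · have h_ne_zero : condMass Y Z μ ω ≠ 0 := ((pos_of_ne_zero ht).trans_le (not_lt.1 hω)).ne'
          have h_ne_top : condMass Y Z μ ω ≠ ∞ := measure_ne_top _ _
          have h_inv : condMass Y Z μ ω * g (condMass Y Z μ ω) = 1 :=
            (congrArg _ (Set.indicator_of_mem (not_lt.1 hω) _)).trans
              (ENNReal.mul_inv_cancel h_ne_zero h_ne_top)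
          rw [← mul_assoc, h_inv, one_mul]
          by_cases h_mem : (X ω, Y ω) ∈ s
          · rw [Set.indicator_of_mem (by exact ⟨h_mem, hω⟩), Set.indicator_of_mem h_mem]
            rfl
          · rw [Set.indicator_of_notMem (fun h => h_mem h.1), Set.indicator_of_notMem h_mem]
    _ ≤ ∫⁻ ω, ∫⁻ x, g (condMass Y Z μ ω) * s.indicator 1 (x, Y ω) ∂(μ.map X) ∂μ :=
        lintegral_condMass_mul_le hX hY hZ hXZ
          (F := fun q => g (condDistrib Y Z μ q.2.1 {q.2.2}) * s.indicator 1 (q.1, q.2.2))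
          ((hgκ.comp measurable_snd).mul (by fun_prop))
    _ = ∫⁻ ω, g (condMass Y Z μ ω) * μ.map X {x | (x, Y ω) ∈ s} ∂μ := by
        congr with ω
        rw [lintegral_const_mul _ (by fun_prop)]
        congr 1
        exact lintegral_indicator_one (measurable_prodMk_right hs)

theorem map_prodMk_le_add_prod (hX : Measurable X) (hY : Measurable Y) (hZ : Measurable Z)
    (hXZ : IndepFun X Z μ) {t : ℝ≥0∞} (ht : t ≠ 0) :
    μ.map (fun ω => (X ω, Y ω)) ≤
      (μ.restrict {ω | condMass Y Z μ ω < t}).map (fun ω => (X ω, Y ω)) + (μ.map X).prod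
        ((μ.withDensity fun ω => (Set.Ici t).indicator (·⁻¹) (condMass Y Z μ ω)).map Y) := by
  have hp := measurable_condMass (μ := μ) hY hZ
  have hg : Measurable ((Set.Ici t).indicator (·⁻¹ : ℝ≥0∞ → ℝ≥0∞)) :=
    measurable_inv.indicator measurableSet_Ici
  have hXY : Measurable fun ω => (X ω, Y ω) := hX.prodMk hY
  refine Measure.le_iff.2 fun s hs => ?_
  have hs_section : Measurable fun y => μ.map X ((fun x => (x, y)) ⁻¹' s) :=
    measurable_measure_prodMk_right hs
  have prod_eq := (lintegral_map hs_section hY).trans <|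
    lintegral_withDensity_eq_lintegral_mul μ (hg.comp hp) (hs_section.comp hY)
  rw [Measure.add_apply, Measure.map_apply hXY hs, Measure.map_apply hXY hs,
    Measure.restrict_apply (hXY hs), Measure.prod_apply_symm hs]
  refine le_of_le_of_eq ?_ (congrArg _ prod_eq.symm)
  rw [← measure_inter_add_sdiff _ (measurableSet_lt hp (measurable_const (a := t)))]
  gcongr
  exact measure_sdiff_condMass_lt_le hX hY hZ hXZ ht hs

theorem lintegral_min_width_le_lintegral_min_one_div [IsProbabilityMeasure P] (hX : Measurable X)
    (hY : Measurable Y) (hZ : Measurable Z) (hXZ : IndepFun X Z μ)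
    (hXY : μ.map (fun ω => (X ω, Y ω)) = P) (hr : Measurable (Function.uncurry r))
    (hP : P = (P.fst.prod P.snd).withDensity (Function.uncurry r)) {t : ℝ≥0∞} (ht : t ≠ 0) :
    ∫⁻ y, (∫⁻ l in Set.Ioi (0 : ℝ), min t (P.fst {x | ENNReal.ofReal l ≤ r x y})) ∂P.snd ≤
      ∫⁻ ω, min 1 (t / condMass Y Z μ ω) ∂μ := by
  have hp := measurable_condMass (μ := μ) hY hZ
  set g : Ω → ℝ≥0∞ := fun ω => (Set.Ici t).indicator (·⁻¹) (condMass Y Z μ ω)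
  have hg : Measurable g := (measurable_inv.indicator measurableSet_Ici).comp hp
  have h_small : MeasurableSet {ω | condMass Y Z μ ω < t} := measurableSet_lt hp measurable_const
  have g_le (ω : Ω) : g ω ≤ t⁻¹ := Set.indicator_le' (fun _ h => ENNReal.inv_le_inv.2 h)
    (fun _ _ => zero_le) _
  have hg_fin : ∫⁻ ω, g ω ∂μ ≠ ∞ := by
    refine ne_top_of_le_ne_top ?_ (lintegral_mono g_le)
    rw [lintegral_const]
    exact ENNReal.mul_ne_top (ENNReal.inv_ne_top.2 ht) (measure_ne_top _ _)
  have : IsFiniteMeasure (μ.withDensity g) := isFiniteMeasure_withDensity hg_fin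
  have map_X : μ.map X = P.fst := by rw [← hXY, Measure.fst_map_prodMk hY]
  have map_Y : μ.map Y = P.snd := by rw [← hXY, Measure.snd_map_prodMk hX]
  have hm : (μ.withDensity g).map Y ≪ P.snd := by
    rw [← map_Y]
    exact (withDensity_absolutelyContinuous μ g).map hY
  have h_le := map_prodMk_le_add_prod hX hY hZ hXZ ht
  rw [hXY, map_X] at h_le
  calc _ ≤ t * (μ.withDensity g).map Y Set.univ +
        (μ.restrict {ω | condMass Y Z μ ω < t}).map (fun ω => (X ω, Y ω)) Set.univ :=
        lintegral_min_width_le hr hP hm h_le t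
    _ = t * ∫⁻ ω, g ω ∂μ + μ {ω | condMass Y Z μ ω < t} := by
        rw [Measure.map_apply hY .univ, Measure.map_apply (hX.prodMk hY) .univ, Set.preimage_univ,
          Set.preimage_univ, withDensity_apply _ .univ, setLIntegral_univ,
          Measure.restrict_apply_univ]
    _ = ∫⁻ ω, min 1 (t / condMass Y Z μ ω) ∂μ := by
        rw [← lintegral_const_mul _ hg, ← lintegral_indicator_one h_small, add_comm,
          ← lintegral_add_right _ (hg.const_mul t)]
        congr with ω
        exact (min_one_div_eq_indicator_add _ _).symm

theorem functionalInformation_le_condEntropy [StandardBorelSpace 𝒳] [Nonempty 𝒳]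
    [IsProbabilityMeasure P] [IsProbabilityMeasure μ]
    (hP : P ≪ P.fst.prod P.snd) (hX : Measurable X) (hY : Measurable Y) (hZ : Measurable Z)
    (hXZ : IndepFun X Z μ) (hXY : μ.map (fun ω => (X ω, Y ω)) = P) :
    functionalInformation P ≤ condEntropy Y Z μ := by
  set r : 𝒳 → 𝒴 → ℝ≥0∞ := Function.curry (P.rnDeriv (P.fst.prod P.snd))
  have hr : Measurable (Function.uncurry r) := Measure.measurable_rnDeriv _ _
  have hP_density : P = (P.fst.prod P.snd).withDensity (Function.uncurry r) :=
    (Measure.withDensity_rnDeriv_eq _ _ hP).symm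
  rw [← ENNReal.add_le_add_iff_left bitsPerNat_ne_top,
    bitsPerNat_add_functionalInformation_eq hr hP_density, bitsPerNat_add_condEntropy_eq hY hZ]
  gcongr bitsPerNat * ?_
  refine setLIntegral_mono' measurableSet_Ioo fun t ht => ?_
  gcongr
  exact lintegral_min_width_le_lintegral_min_one_div hX hY hZ hXZ hXY hr hP_density
    (by simpa using ht.1)

theorem functionalInformation_le_minRate [StandardBorelSpace 𝒳] [Nonempty 𝒳]
    [IsProbabilityMeasure P] (hP : P ≪ P.fst.prod P.snd) :
    functionalInformation P ≤ minRate.{u, v, w} P := by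
  refine le_sInf ?_
  rintro _ ⟨𝒵, _, _, μ, _, h, rfl⟩
  exact functionalInformation_le_condEntropy hP measurable_fst (by fun_prop) (by fun_prop) h.indep
    h.map_eq

end CondMass

section Codes

theorem condEntropy_map {Ω Ω' : Type*} {𝒴 : Type v} {𝒵 : Type w} [MeasurableSpace Ω]
    [MeasurableSpace Ω'] [MeasurableSpace 𝒴] [StandardBorelSpace 𝒴] [Nonempty 𝒴]
    [MeasurableSpace 𝒵] {ν : Measure Ω'} [IsFiniteMeasure ν] {φ : Ω' → Ω} (hφ : Measurable φ)
    {Y : Ω → 𝒴} (hY : Measurable Y) {Z : Ω → 𝒵} (hZ : Measurable Z) :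
    condEntropy Y Z (ν.map φ) = condEntropy (Y ∘ φ) (Z ∘ φ) ν := by
  unfold condEntropy
  rw [Measure.map_map hZ hφ]
  refine lintegral_congr_ae ?_
  filter_upwards [condDistrib_map (ν := ν) (f := φ) hZ.aemeasurable hY.aemeasurable
    hφ.aemeasurable] with z hz
  rw [hz]

variable {𝒳 : Type u} {𝒴 : Type v} [MeasurableSpace 𝒳] [MeasurableSpace 𝒴] {W : Kernel 𝒳 𝒴}

section JointLaw

variable {𝒵 : Type w} [MeasurableSpace 𝒵] (C : StochasticCode W 𝒵)

theorem StochasticCode.measurable_output :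
    Measurable fun p : 𝒳 × 𝒵 => C.dec (C.enc p.1 p.2) p.2 := by
  intro s hs
  have : (fun p : 𝒳 × 𝒵 => C.dec (C.enc p.1 p.2) p.2) ⁻¹' s =
      ⋃ l, {p : 𝒳 × 𝒵 | C.enc p.1 p.2 = l} ∩ {p | C.dec l p.2 ∈ s} := by
    ext p
    simp
  rw [this]
  exact MeasurableSet.iUnion fun l =>
    (C.measurableSet_enc l).inter ((C.measurable_dec l).comp measurable_snd hs)

/-- The joint law of the input, the output and the common randomness of a code. -/
noncomputable def StochasticCode.jointLaw (PX : Measure 𝒳) : Measure (𝒳 × 𝒴 × 𝒵) :=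
  (PX.prod C.law).map fun p => (p.1, C.dec (C.enc p.1 p.2) p.2, p.2)

theorem StochasticCode.measurable_prodMk_output :
    Measurable fun p : 𝒳 × 𝒵 => (p.1, C.dec (C.enc p.1 p.2) p.2, p.2) :=
  measurable_fst.prodMk (C.measurable_output.prodMk measurable_snd)

variable (PX : Measure 𝒳) [IsProbabilityMeasure PX]

instance StochasticCode.isProbabilityMeasure_jointLaw : IsProbabilityMeasure (C.jointLaw PX) :=
  Measure.isProbabilityMeasure_map C.measurable_prodMk_output.aemeasurable

theorem StochasticCode.isCommonRandomness_jointLaw [IsSFiniteKernel W] :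
    IsCommonRandomness (PX ⊗ₘ W) (C.jointLaw PX) where
  map_eq := by
    have h_meas := measurable_fst.prodMk C.measurable_output
    rw [jointLaw, Measure.map_map (by fun_prop) C.measurable_prodMk_output]
    ext s hs
    refine (Measure.map_apply h_meas hs).trans ?_
    rw [Measure.compProd_apply hs, Measure.prod_apply (hs.preimage h_meas)]
    congr 1 with x
    rw [← C.map_eq x]
    exact (Measure.map_apply (C.measurable_output.comp measurable_prodMk_left)
      (measurable_prodMk_left hs)).symm
  indep := by
    rw [indepFun_iff_map_prod_eq_prod_map_map (by fun_prop) (by fun_prop), jointLaw,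
      Measure.map_map (by fun_prop) C.measurable_prodMk_output,
      Measure.map_map (by fun_prop) C.measurable_prodMk_output,
      Measure.map_map (by fun_prop) C.measurable_prodMk_output]
    change (PX.prod C.law).map id =
      ((PX.prod C.law).map Prod.fst).prod ((PX.prod C.law).map Prod.snd)
    simp [Measure.map_fst_prod, Measure.map_snd_prod]

theorem StochasticCode.rate_eq_condEntropy_jointLaw [StandardBorelSpace 𝒴] [Nonempty 𝒴] :
    C.rate PX = condEntropy (fun t => t.2.1) (fun t => t.2.2) (C.jointLaw PX) :=
  (condEntropy_map (Y := fun t : 𝒳 × 𝒴 × 𝒵 => t.2.1) (Z := fun t => t.2.2)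
    C.measurable_prodMk_output (by fun_prop) (by fun_prop)).symm

end JointLaw

theorem minRate_le_minCodeRate [StandardBorelSpace 𝒴] [Nonempty 𝒴] [IsSFiniteKernel W]
    (PX : Measure 𝒳) [IsProbabilityMeasure PX] :
    minRate.{u, v, w} (PX ⊗ₘ W) ≤ minCodeRate.{u, v, w} PX W := by
  refine le_sInf ?_
  rintro _ ⟨𝒵, _, _, C, rfl⟩
  exact sInf_le ⟨𝒵, inferInstance, inferInstance, C.jointLaw PX, inferInstance,
    C.isCommonRandomness_jointLaw PX, C.rate_eq_condEntropy_jointLaw PX⟩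

end Codes

/-- A sequence of independent random variables on `(𝒵, law)`, all with law `lam`. -/
structure IsIIDSequence {𝒵 E : Type*} [MeasurableSpace 𝒵] [MeasurableSpace E] (V : ℕ → 𝒵 → E)
    (law : Measure 𝒵) (lam : Measure E) : Prop where
  measurable : ∀ k, Measurable (V k)
  iIndepFun : iIndepFun V law
  map_eq : ∀ k, law.map (V k) = lam

section FirstHit

variable {𝒵 E : Type*} {S : Set E} {V : ℕ → 𝒵 → E}

/-- The event that `k` is the first index at which the sequence `V` lies in `S`. -/
def firstHitEvent (S : Set E) (V : ℕ → 𝒵 → E) (k : ℕ) : Set 𝒵 :=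
  {z | V k z ∈ S ∧ ∀ j < k, V j z ∉ S}

/-- The first index at which the sequence `V` lies in `S`, and `0` if there is none. -/
noncomputable def firstHit (S : Set E) (V : ℕ → 𝒵 → E) (z : 𝒵) : ℕ :=
  sInf {k | V k z ∈ S}

theorem firstHit_eq_of_mem_firstHitEvent {k : ℕ} {z : 𝒵} (hz : z ∈ firstHitEvent S V k) :
    firstHit S V z = k :=
  le_antisymm (Nat.sInf_le hz.1)
    (not_lt.1 fun h_lt => hz.2 _ h_lt (Nat.sInf_mem (s := {k | V k z ∈ S}) ⟨k, hz.1⟩))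

theorem firstHit_eq_iff {k : ℕ} {z : 𝒵} :
    firstHit S V z = k ↔ z ∈ firstHitEvent S V k ∨ (k = 0 ∧ ∀ j, V j z ∉ S) := by
  constructor
  · rintro rfl
    by_cases h : ∃ j, V j z ∈ S
    · exact .inl ⟨Nat.sInf_mem h, fun j hj => Nat.notMem_of_lt_sInf hj⟩
    · push Not at h
      exact .inr ⟨Nat.sInf_eq_zero.2 (.inr (Set.eq_empty_of_forall_notMem h)), h⟩
  · rintro (hz | ⟨rfl, h⟩)
    · exact firstHit_eq_of_mem_firstHitEvent hz
    · exact Nat.sInf_eq_zero.2 (.inr (Set.eq_empty_of_forall_notMem h))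

theorem pairwise_disjoint_firstHitEvent : Pairwise (Function.onFun Disjoint (firstHitEvent S V)) :=
  fun _ _ hij => Set.disjoint_left.2 fun _ hi hj => hij <|
    (firstHit_eq_of_mem_firstHitEvent hi).symm.trans (firstHit_eq_of_mem_firstHitEvent hj)

variable [MeasurableSpace 𝒵] [MeasurableSpace E]

theorem measurableSet_firstHitEvent (hS : MeasurableSet S) (hV : ∀ k, Measurable (V k)) (k : ℕ) :
    MeasurableSet (firstHitEvent S V k) := by
  have : firstHitEvent S V k = V k ⁻¹' S ∩ ⋂ j, ⋂ (_ : j < k), V j ⁻¹' Sᶜ := by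
    ext z
    simp [firstHitEvent]
  rw [this]
  exact (hV k hS).inter (.iInter fun j => .iInter fun _ => hV j hS.compl)

theorem measurable_firstHit (hS : MeasurableSet S) (hV : ∀ k, Measurable (V k)) :
    Measurable (firstHit S V) := by
  refine measurable_to_countable' fun k => ?_
  have : firstHit S V ⁻¹' {k} = firstHitEvent S V k ∪ {_z | k = 0} ∩ ⋂ j, V j ⁻¹' Sᶜ := by
    ext z
    simpa using firstHit_eq_iff
  rw [this]
  exact (measurableSet_firstHitEvent hS hV k).union
    ((MeasurableSet.const _).inter (.iInter fun j => hV j hS.compl))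

theorem measurable_apply_firstHit (hS : MeasurableSet S) (hV : ∀ k, Measurable (V k)) :
    Measurable fun z => V (firstHit S V z) z :=
  (measurable_from_prod_countable_right (f := fun q : ℕ × 𝒵 => V q.1 q.2) hV).comp
    ((measurable_firstHit hS hV).prodMk measurable_id)

variable {law : Measure 𝒵} {lam : Measure E}

theorem IsIIDSequence.isProbabilityMeasure (hV : IsIIDSequence V law lam) :
    IsProbabilityMeasure lam := by
  have := hV.iIndepFun.isProbabilityMeasure
  rw [← hV.map_eq 0]
  exact Measure.isProbabilityMeasure_map (hV.measurable 0).aemeasurable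

theorem IsIIDSequence.lintegral_mul_prod (hV : IsIIDSequence V law lam) {f g : E → ℝ≥0∞}
    (hf : Measurable f) (hg : Measurable g) (k : ℕ) :
    ∫⁻ z, f (V k z) * ∏ j ∈ Finset.range k, g (V j z) ∂law =
      (∫⁻ v, f v ∂lam) * (∫⁻ v, g v ∂lam) ^ k := by
  set φ : ℕ → E → ℝ≥0∞ := Function.update (fun _ => g) k f
  have hφ (j : ℕ) : Measurable (φ j) := by
    rcases eq_or_ne j k with rfl | hj
    · simpa [φ] using hf
    · simpa [φ, hj] using hg
  have h_range {j : ℕ} (hj : j ∈ Finset.range k) : φ j = g :=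
    Function.update_of_ne (Finset.mem_range.1 hj).ne _ _
  calc ∫⁻ z, f (V k z) * ∏ j ∈ Finset.range k, g (V j z) ∂law
      = ∫⁻ z, ∏ j ∈ Finset.range (k + 1), φ j (V j z) ∂law := by
        congr 1 with z
        rw [Finset.prod_range_succ, mul_comm]
        congr 1
        · exact Finset.prod_congr rfl fun j hj => by rw [h_range hj]
        · simp [φ]
    _ = ∏ j ∈ Finset.range (k + 1), ∫⁻ z, φ j (V j z) ∂law :=
        lintegral_prod_eq_prod_lintegral_of_indepFun _ _ (hV.iIndepFun.comp φ hφ)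
          fun j => (hφ j).comp (hV.measurable j)
    _ = ∏ j ∈ Finset.range (k + 1), ∫⁻ v, φ j v ∂lam :=
        Finset.prod_congr rfl fun j _ => by
          rw [← hV.map_eq j, lintegral_map (hφ j) (hV.measurable j)]
    _ = (∫⁻ v, f v ∂lam) * (∫⁻ v, g v ∂lam) ^ k := by
        rw [Finset.prod_range_succ, mul_comm, Finset.prod_congr rfl fun j hj => by rw [h_range hj],
          Finset.prod_const, Finset.card_range]
        simp [φ]

theorem IsIIDSequence.setLIntegral_firstHitEvent (hV : IsIIDSequence V law lam)
    (hS : MeasurableSet S) {h : E → ℝ≥0∞} (hh : Measurable h) (k : ℕ) :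
    ∫⁻ z in firstHitEvent S V k, h (V k z) ∂law = (∫⁻ v in S, h v ∂lam) * lam Sᶜ ^ k := by
  classical
  rw [← lintegral_indicator (measurableSet_firstHitEvent hS hV.measurable k),
    ← lintegral_indicator hS, ← lintegral_indicator_one hS.compl,
    ← hV.lintegral_mul_prod (hh.indicator hS) (measurable_one.indicator hS.compl)]
  congr 1 with z
  have h_prod : ∏ j ∈ Finset.range k, Sᶜ.indicator (1 : E → ℝ≥0∞) (V j z) =
      if ∀ j < k, V j z ∉ S then 1 else 0 := by
    simp only [Set.indicator_apply, Pi.one_apply, Finset.prod_ite_zero, Finset.prod_const_one,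
      Set.mem_compl_iff, Finset.mem_range]
  rw [h_prod, mul_ite, mul_one, mul_zero]
  simp only [Set.indicator_apply, firstHitEvent, Set.mem_ofPred_eq, and_comm (a := V k z ∈ S),
    ite_and]

theorem tsum_measure_compl_pow [IsProbabilityMeasure lam] (hS : MeasurableSet S) :
    ∑' k : ℕ, lam Sᶜ ^ k = (lam S)⁻¹ := by
  rw [ENNReal.tsum_geometric, prob_compl_eq_one_sub hS,
    ENNReal.sub_sub_cancel ENNReal.one_ne_top prob_le_one]

theorem IsIIDSequence.measure_firstHitEvent_inter (hV : IsIIDSequence V law lam)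
    (hS : MeasurableSet S) {T : Set E} (hT : MeasurableSet T) (k : ℕ) :
    law (firstHitEvent S V k ∩ V k ⁻¹' T) = lam (S ∩ T) * lam Sᶜ ^ k := by
  have hVT := hV.measurable k hT
  calc law (firstHitEvent S V k ∩ V k ⁻¹' T)
      = ∫⁻ z in firstHitEvent S V k, T.indicator 1 (V k z) ∂law := by
        rw [Set.inter_comm, ← Measure.restrict_apply hVT, ← lintegral_indicator_one hVT]
        rfl
    _ = lam (S ∩ T) * lam Sᶜ ^ k := by
        rw [hV.setLIntegral_firstHitEvent hS (measurable_one.indicator hT),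
          lintegral_indicator_one hT, Measure.restrict_apply hT, Set.inter_comm]

theorem IsIIDSequence.measure_iUnion_firstHitEvent_inter (hV : IsIIDSequence V law lam)
    (hS : MeasurableSet S) {T : Set E} (hT : MeasurableSet T) :
    law (⋃ k, firstHitEvent S V k ∩ V k ⁻¹' T) = lam[T | S] := by
  have := hV.isProbabilityMeasure
  calc law (⋃ k, firstHitEvent S V k ∩ V k ⁻¹' T)
      = ∑' k, law (firstHitEvent S V k ∩ V k ⁻¹' T) :=
        measure_iUnion (fun i j hij => (pairwise_disjoint_firstHitEvent hij).mono
          Set.inter_subset_left Set.inter_subset_left) fun k =>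
            (measurableSet_firstHitEvent hS hV.measurable k).inter (hV.measurable k hT)
    _ = ∑' k, lam (S ∩ T) * lam Sᶜ ^ k := by simp only [hV.measure_firstHitEvent_inter hS hT]
    _ = lam[T | S] := by
        rw [cond_apply hS, ENNReal.tsum_mul_left, tsum_measure_compl_pow hS, mul_comm]

theorem IsIIDSequence.measure_forall_notMem (hV : IsIIDSequence V law lam) (hS : MeasurableSet S)
    (hS0 : lam S ≠ 0) : law {z | ∀ j, V j z ∉ S} = 0 := by
  have := hV.iIndepFun.isProbabilityMeasure
  have := hV.isProbabilityMeasure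
  have := cond_isProbabilityMeasure hS0
  have h_hit : law (⋃ k, firstHitEvent S V k) = 1 := by
    simpa using hV.measure_iUnion_firstHitEvent_inter hS .univ
  have h_miss : law (⋃ k, firstHitEvent S V k)ᶜ = 0 :=
    (prob_compl_eq_zero_iff (.iUnion (measurableSet_firstHitEvent hS hV.measurable))).2 h_hit
  refine measure_mono_null (fun z hz => ?_) h_miss
  simp only [Set.mem_compl_iff, Set.mem_iUnion, not_exists]
  exact fun k hk => hz k hk.1

theorem IsIIDSequence.map_apply_firstHit (hV : IsIIDSequence V law lam) (hS : MeasurableSet S)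
    (hS0 : lam S ≠ 0) : law.map (fun z => V (firstHit S V z) z) = lam[|S] := by
  have := hV.iIndepFun.isProbabilityMeasure
  have := hV.isProbabilityMeasure
  have := cond_isProbabilityMeasure hS0
  have h_meas := measurable_apply_firstHit hS hV.measurable
  have := Measure.isProbabilityMeasure_map (μ := law) h_meas.aemeasurable
  refine (Measure.eq_of_le_of_isProbabilityMeasure (Measure.le_iff.2 fun T hT => ?_)).symm
  rw [← hV.measure_iUnion_firstHitEvent_inter hS hT, Measure.map_apply h_meas hT]
  refine measure_mono (Set.iUnion_subset fun k z hz => ?_)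
  rw [Set.mem_preimage, firstHit_eq_of_mem_firstHitEvent hz.1]
  exact hz.2

end FirstHit

section RejectionSampling

variable {𝒳 𝒵 E : Type*} [MeasurableSpace 𝒳] {A : Set (𝒳 × E)} {V : ℕ → 𝒵 → E}

/-- The probability, over `X ∼ PX` and at a fixed value `z` of the common randomness, that `k` is
the first index with `(X, V k z) ∈ A`. -/
noncomputable def firstHitProb (PX : Measure 𝒳) (A : Set (𝒳 × E)) (V : ℕ → 𝒵 → E) (k : ℕ)
    (z : 𝒵) : ℝ≥0∞ :=
  PX {x | z ∈ firstHitEvent (Prod.mk x ⁻¹' A) V k}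

variable {PX : Measure 𝒳}

theorem measure_firstHit_eq_firstHitProb {z : 𝒵} (hz : PX {x | ∀ j, (x, V j z) ∉ A} = 0) (k : ℕ) :
    PX {x | firstHit (Prod.mk x ⁻¹' A) V z = k} = firstHitProb PX A V k z := by
  refine le_antisymm ?_ (measure_mono fun x => firstHit_eq_of_mem_firstHitEvent)
  calc PX {x | firstHit (Prod.mk x ⁻¹' A) V z = k}
      ≤ PX ({x | z ∈ firstHitEvent (Prod.mk x ⁻¹' A) V k} ∪ {x | ∀ j, (x, V j z) ∉ A}) :=
        measure_mono fun x hx => (firstHit_eq_iff.1 hx).imp_right And.right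
    _ ≤ firstHitProb PX A V k z + 0 := hz ▸ measure_union_le _ _
    _ = firstHitProb PX A V k z := add_zero _

variable [MeasurableSpace 𝒵] [MeasurableSpace E]

theorem measurableSet_mem_firstHitEvent_section (hA : MeasurableSet A)
    (hV : ∀ k, Measurable (V k)) (k : ℕ) :
    MeasurableSet {p : 𝒳 × 𝒵 | p.2 ∈ firstHitEvent (Prod.mk p.1 ⁻¹' A) V k} :=
  measurableSet_firstHitEvent (V := fun k => Prod.map id (V k)) hA
    (fun k => measurable_id.prodMap (hV k)) k

theorem measurable_firstHit_section (hA : MeasurableSet A) (hV : ∀ k, Measurable (V k)) :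
    Measurable fun p : 𝒳 × 𝒵 => firstHit (Prod.mk p.1 ⁻¹' A) V p.2 :=
  measurable_firstHit (V := fun k => Prod.map id (V k)) hA fun k => measurable_id.prodMap (hV k)

theorem measurable_apply_firstHit_section (hA : MeasurableSet A) (hV : ∀ k, Measurable (V k)) :
    Measurable fun p : 𝒳 × 𝒵 => V (firstHit (Prod.mk p.1 ⁻¹' A) V p.2) p.2 :=
  measurable_snd.comp <| measurable_apply_firstHit (V := fun k => Prod.map id (V k)) hA
    fun k => measurable_id.prodMap (hV k)

variable {law : Measure 𝒵} {lam : Measure E}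

theorem measurable_firstHitProb [SFinite PX] (hA : MeasurableSet A) (hV : ∀ k, Measurable (V k))
    (k : ℕ) : Measurable (firstHitProb PX A V k) :=
  measurable_measure_prodMk_right (measurableSet_mem_firstHitEvent_section hA hV k)

variable [IsProbabilityMeasure PX] {a : ℝ≥0∞}

theorem lintegral_measure_section_eq [SFinite lam] (hA : MeasurableSet A)
    (ha : ∀ x, lam (Prod.mk x ⁻¹' A) = a) : ∫⁻ v, PX {x | (x, v) ∈ A} ∂lam = a := by
  rw [← lintegral_measure_prodMk_comm PX lam hA]
  refine (lintegral_congr ha).trans ?_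
  simp

theorem IsIIDSequence.lintegral_firstHitProb_mul (hV : IsIIDSequence V law lam)
    (hA : MeasurableSet A) (ha : ∀ x, lam (Prod.mk x ⁻¹' A) = a) {h : E → ℝ≥0∞}
    (hh : Measurable h) (k : ℕ) :
    ∫⁻ z, firstHitProb PX A V k z * h (V k z) ∂law =
      (∫⁻ v, PX {x | (x, v) ∈ A} * h v ∂lam) * (1 - a) ^ k := by
  have := hV.iIndepFun.isProbabilityMeasure
  have := hV.isProbabilityMeasure
  have hA_section (x : 𝒳) : MeasurableSet (Prod.mk x ⁻¹' A) := measurable_prodMk_left hA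
  calc ∫⁻ z, firstHitProb PX A V k z * h (V k z) ∂law
      = ∫⁻ x, (∫⁻ z in firstHitEvent (Prod.mk x ⁻¹' A) V k, h (V k z) ∂law) ∂PX :=
        lintegral_measure_prodMk_mul PX law
          (measurableSet_mem_firstHitEvent_section hA hV.measurable k) (hh.comp (hV.measurable k))
    _ = ∫⁻ x, (∫⁻ v in Prod.mk x ⁻¹' A, h v ∂lam) * (1 - a) ^ k ∂PX := by
        refine lintegral_congr fun x => ?_
        rw [hV.setLIntegral_firstHitEvent (hA_section x) hh, prob_compl_eq_one_sub (hA_section x),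
          ha]
    _ = (∫⁻ v, PX {x | (x, v) ∈ A} * h v ∂lam) * (1 - a) ^ k := by
        rw [lintegral_mul_const' _ _ (ENNReal.pow_ne_top (ENNReal.sub_ne_top ENNReal.one_ne_top)),
          lintegral_measure_prodMk_mul PX lam hA hh]
        rfl

theorem IsIIDSequence.lintegral_firstHitProb (hV : IsIIDSequence V law lam)
    (hA : MeasurableSet A) (ha : ∀ x, lam (Prod.mk x ⁻¹' A) = a) (k : ℕ) :
    ∫⁻ z, firstHitProb PX A V k z ∂law = a * (1 - a) ^ k := by
  have := hV.isProbabilityMeasure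
  simpa [lintegral_measure_section_eq hA ha] using
    hV.lintegral_firstHitProb_mul (PX := PX) hA ha (measurable_const (a := 1)) k

/-- Gibbs' inequality against the weights `PX {x | (x, V k z) ∈ A} * (1 - a) ^ k`, the
probability of a first hit at `k` after averaging out the proposals `V j z` with `j < k`. -/
theorem IsIIDSequence.lintegral_firstHitProb_mul_surprisal_le
    (hV : IsIIDSequence V law lam) (hA : MeasurableSet A) (ha : ∀ x, lam (Prod.mk x ⁻¹' A) = a)
    (k : ℕ) :
    ∫⁻ z, firstHitProb PX A V k z * surprisal (firstHitProb PX A V k z) ∂law ≤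
      (∫⁻ v, PX {x | (x, v) ∈ A} * surprisal (PX {x | (x, v) ∈ A}) ∂lam) * (1 - a) ^ k +
        a * ((1 - a) ^ k * surprisal ((1 - a) ^ k)) := by
  have := hV.isProbabilityMeasure
  set π : 𝒵 → ℝ≥0∞ := firstHitProb PX A V k
  set α : E → ℝ≥0∞ := fun v => PX {x | (x, v) ∈ A}
  set q : ℝ≥0∞ := (1 - a) ^ k
  have hπ : Measurable π := measurable_firstHitProb hA hV.measurable k
  have hα : Measurable α := measurable_measure_prodMk_right hA
  have hαk : Measurable fun z => α (V k z) := hα.comp (hV.measurable k)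
  have hq : q ≤ 1 := pow_le_one₀ zero_le tsub_le_self
  have lintegral_α_comp : ∫⁻ z, α (V k z) ∂law = a := by
    rw [← lintegral_map hα (hV.measurable k), hV.map_eq, lintegral_measure_section_eq hA ha]
  have lintegral_π : ∫⁻ z, π z ∂law = a * q := hV.lintegral_firstHitProb hA ha k
  have lintegral_π_surprisal :
      ∫⁻ z, π z * surprisal (α (V k z)) ∂law = (∫⁻ v, α v * surprisal (α v) ∂lam) * q :=
    hV.lintegral_firstHitProb_mul hA ha (measurable_surprisal.comp hα) k
  have h_fin : bitsPerNat * (a * q) ≠ ∞ := by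
    obtain ⟨x⟩ := nonempty_of_isProbabilityMeasure PX
    exact ENNReal.mul_ne_top bitsPerNat_ne_top
      (ENNReal.mul_ne_top (ha x ▸ measure_ne_top _ _) (ne_top_of_le_ne_top ENNReal.one_ne_top hq))
  have gibbs (z : 𝒵) : π z * surprisal (π z) + bitsPerNat * π z ≤
      π z * surprisal (α (V k z)) + π z * surprisal q + bitsPerNat * (α (V k z) * q) := by
    rw [← mul_add, ← surprisal_mul prob_le_one hq]
    exact mul_surprisal_add_le prob_le_one (mul_le_one' prob_le_one hq)
  refine (ENNReal.add_le_add_iff_right h_fin).1 ?_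
  calc ∫⁻ z, π z * surprisal (π z) ∂law + bitsPerNat * (a * q)
      = ∫⁻ z, (π z * surprisal (π z) + bitsPerNat * π z) ∂law := by
        rw [lintegral_add_right _ (hπ.const_mul _), lintegral_const_mul _ hπ, lintegral_π]
    _ ≤ ∫⁻ z, (π z * surprisal (α (V k z)) + π z * surprisal q +
          bitsPerNat * (α (V k z) * q)) ∂law := lintegral_mono gibbs
    _ = (∫⁻ v, α v * surprisal (α v) ∂lam) * q + a * (q * surprisal q) +
          bitsPerNat * (a * q) := by
        rw [lintegral_add_right _ ((hαk.mul_const _).const_mul _),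
          lintegral_add_right _ (hπ.mul_const _), lintegral_const_mul _ (hαk.mul_const _),
          lintegral_mul_const _ hαk, lintegral_mul_const _ hπ, lintegral_α_comp, lintegral_π,
          mul_assoc a, lintegral_π_surprisal]

theorem IsIIDSequence.lintegral_tsum_firstHitProb_mul_surprisal_le
    (hV : IsIIDSequence V law lam) (hA : MeasurableSet A) (ha : ∀ x, lam (Prod.mk x ⁻¹' A) = a)
    (ha0 : a ≠ 0) :
    ∫⁻ z, ∑' k, firstHitProb PX A V k z * surprisal (firstHitProb PX A V k z) ∂law ≤
      a⁻¹ * ∫⁻ v, PX {x | (x, v) ∈ A} * surprisal (PX {x | (x, v) ∈ A}) ∂lam + bitsPerNat := by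
  have := hV.isProbabilityMeasure
  have hq : 1 - a < 1 := ENNReal.sub_lt_self ENNReal.one_ne_top one_ne_zero ha0
  have one_sub_q : 1 - (1 - a) = a := by
    obtain ⟨x⟩ := nonempty_of_isProbabilityMeasure PX
    exact ENNReal.sub_sub_cancel ENNReal.one_ne_top (ha x ▸ prob_le_one)
  have h_meas (k : ℕ) : Measurable (firstHitProb PX A V k) :=
    measurable_firstHitProb hA hV.measurable k
  have h_meas_mul (k : ℕ) :
      Measurable fun z => firstHitProb PX A V k z * surprisal (firstHitProb PX A V k z) :=
    (h_meas k).mul (measurable_surprisal.comp (h_meas k))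
  rw [lintegral_tsum fun k => (h_meas_mul k).aemeasurable]
  refine (ENNReal.tsum_le_tsum (hV.lintegral_firstHitProb_mul_surprisal_le hA ha)).trans ?_
  rw [ENNReal.tsum_add, ENNReal.tsum_mul_left, ENNReal.tsum_mul_left, ENNReal.tsum_geometric,
    one_sub_q, mul_comm]
  gcongr
  simpa only [one_sub_q] using tsum_geometric_mul_surprisal_le hq

theorem entropy_map_le_tsum {𝒴 : Type v} [MeasurableSpace 𝒴] [MeasurableSingletonClass 𝒴]
    {K : 𝒳 → ℕ} (hK : Measurable K) (g : ℕ → 𝒴) :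
    entropy (PX.map fun x => g (K x)) ≤ ∑' k, PX {x | K x = k} * surprisal (PX {x | K x = k}) := by
  have hg : Measurable g := measurable_of_countable g
  have h_singleton (k : ℕ) : PX.map K {k} = PX {x | K x = k} :=
    Measure.map_apply hK (measurableSet_singleton k)
  have := Measure.isProbabilityMeasure_map (μ := PX) hK.aemeasurable
  have := Measure.isProbabilityMeasure_map (μ := PX.map K) hg.aemeasurable
  calc entropy (PX.map fun x => g (K x)) = entropy ((PX.map K).map g) := by
        rw [Measure.map_map hg hK, Function.comp_def]
    _ ≤ ∫⁻ k, surprisal ((PX.map K).map g {g k}) ∂(PX.map K) := lintegral_map_le _ g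
    _ ≤ ∫⁻ k, surprisal (PX.map K {k}) ∂(PX.map K) := by
        refine lintegral_mono fun k => antitoneOn_surprisal prob_le_one prob_le_one ?_
        rw [Measure.map_apply hg (measurableSet_singleton _)]
        exact measure_mono (by simp)
    _ = ∑' k, PX {x | K x = k} * surprisal (PX {x | K x = k}) := by
        simp only [lintegral_countable', h_singleton, mul_comm]

end RejectionSampling

section RejectionCode

variable {𝒳 : Type u} {𝒴 : Type v} {𝒵 : Type w} [MeasurableSpace 𝒳]
  [MeasurableSpace 𝒴] [MeasurableSpace 𝒵]

theorem condDistrib_uncurry_snd_ae_eq [StandardBorelSpace 𝒴] [Nonempty 𝒴]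
    (μ : Measure 𝒳) [IsProbabilityMeasure μ] (ν : Measure 𝒵) [IsProbabilityMeasure ν]
    {f : 𝒳 × 𝒵 → 𝒴} (hf : Measurable f) :
    ∀ᵐ z ∂ν, condDistrib f Prod.snd (μ.prod ν) z = μ.map fun x => f (x, z) := by
  have hfz (z : 𝒵) : Measurable fun x => f (x, z) := hf.comp measurable_prodMk_right
  let κ : Kernel 𝒵 𝒴 := (Kernel.const 𝒵 μ ×ₖ Kernel.id).map f
  have κ_apply (z : 𝒵) : κ z = μ.map fun x => f (x, z) := by
    rw [Kernel.map_apply _ hf, Kernel.prod_apply, Kernel.const_apply, Kernel.id_apply,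
      Measure.prod_dirac, Measure.map_map hf measurable_prodMk_right]
    rfl
  have : IsMarkovKernel κ := Kernel.IsMarkovKernel.map _ hf
  have h_map_snd : (μ.prod ν).map Prod.snd = ν := by simp [Measure.map_snd_prod]
  have h_compProd :
      (μ.prod ν).map (fun p => (p.2, f p)) = (μ.prod ν).map Prod.snd ⊗ₘ κ := by
    rw [h_map_snd]
    ext s hs
    have h_meas : Measurable fun p : 𝒳 × 𝒵 => (p.2, f p) := measurable_snd.prodMk hf
    rw [Measure.map_apply h_meas hs, Measure.compProd_apply hs,
      Measure.prod_apply_symm (h_meas hs)]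
    congr 1 with z
    rw [κ_apply]
    exact (Measure.map_apply (hfz z) (measurable_prodMk_left hs)).symm
  have h := condDistrib_ae_eq_of_measure_eq_compProd Prod.snd hf.aemeasurable h_compProd
  rw [h_map_snd] at h
  exact h.mono fun z hz => hz.trans (κ_apply z)

variable {E : Type*} [MeasurableSpace E] {A : Set (𝒳 × E)} {V : ℕ → 𝒵 → E} {law : Measure 𝒵}
  {lam : Measure E} {g : E → 𝒴} {W : Kernel 𝒳 𝒴}

/-- The rejection sampling code: the common randomness provides independent proposals `V k` with
law `lam`, the encoder sends, in unary, the first index `k` with `(x, V k z) ∈ A`, and the decoder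
outputs `g (V k z)`. -/
noncomputable def rejectionCode (hA : MeasurableSet A) (hV : IsIIDSequence V law lam)
    (hg : Measurable g) (hA0 : ∀ x, lam (Prod.mk x ⁻¹' A) ≠ 0)
    (hW : ∀ x, W x = (lam[|Prod.mk x ⁻¹' A]).map g) : StochasticCode W 𝒵 where
  law := law
  isProbabilityMeasure_law := hV.iIndepFun.isProbabilityMeasure
  enc x z := List.replicate (firstHit (Prod.mk x ⁻¹' A) V z) true
  dec s z := g (V s.length z)
  measurableSet_enc s := measurable_firstHit_section hA hV.measurable
    (MeasurableSet.of_discrete (s := {k | List.replicate k true = s}))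
  measurable_dec s := hg.comp (hV.measurable _)
  map_eq x := by
    have hA_section : MeasurableSet (Prod.mk x ⁻¹' A) := measurable_prodMk_left hA
    rw [hW, ← hV.map_apply_firstHit hA_section (hA0 x),
      Measure.map_map hg (measurable_apply_firstHit hA_section hV.measurable)]
    simp only [List.length_replicate, Function.comp_def]

variable {PX : Measure 𝒳} [IsProbabilityMeasure PX]

theorem IsIIDSequence.ae_measure_forall_notMem_section (hV : IsIIDSequence V law lam)
    (hA : MeasurableSet A) (hA0 : ∀ x, lam (Prod.mk x ⁻¹' A) ≠ 0) :
    ∀ᵐ z ∂law, PX {x | ∀ j, (x, V j z) ∉ A} = 0 := by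
  have := hV.iIndepFun.isProbabilityMeasure
  have h_meas : MeasurableSet {p : 𝒳 × 𝒵 | ∀ j, (p.1, V j p.2) ∉ A} := by
    simp only [Set.ofPred_forall]
    exact .iInter fun j => (measurable_fst.prodMk ((hV.measurable j).comp measurable_snd)) hA.compl
  have h_null : PX.prod law {p : 𝒳 × 𝒵 | ∀ j, (p.1, V j p.2) ∉ A} = 0 := by
    rw [Measure.measure_prod_null h_meas]
    exact .of_forall fun x => hV.measure_forall_notMem (measurable_prodMk_left hA) (hA0 x)
  rwa [Measure.prod_apply_symm h_meas,
    lintegral_eq_zero_iff (measurable_measure_prodMk_right h_meas)] at h_null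

theorem rate_rejectionCode_le [StandardBorelSpace 𝒴] [Nonempty 𝒴] (hA : MeasurableSet A)
    (hV : IsIIDSequence V law lam) (hg : Measurable g) (hA0 : ∀ x, lam (Prod.mk x ⁻¹' A) ≠ 0)
    (hW : ∀ x, W x = (lam[|Prod.mk x ⁻¹' A]).map g) {a : ℝ≥0∞}
    (ha : ∀ x, lam (Prod.mk x ⁻¹' A) = a) :
    (rejectionCode hA hV hg hA0 hW).rate PX ≤
      a⁻¹ * ∫⁻ v, PX {x | (x, v) ∈ A} * surprisal (PX {x | (x, v) ∈ A}) ∂lam + bitsPerNat := by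
  have := hV.iIndepFun.isProbabilityMeasure
  have ha0 : a ≠ 0 := by
    obtain ⟨x⟩ := nonempty_of_isProbabilityMeasure PX
    exact ha x ▸ hA0 x
  let Y (p : 𝒳 × 𝒵) : 𝒴 := g (V (firstHit (Prod.mk p.1 ⁻¹' A) V p.2) p.2)
  have hY : Measurable Y := hg.comp (measurable_apply_firstHit_section hA hV.measurable)
  have h_map_snd : (PX.prod law).map Prod.snd = law := by simp [Measure.map_snd_prod]
  calc (rejectionCode hA hV hg hA0 hW).rate PX
      = ∫⁻ z, entropy (condDistrib Y Prod.snd (PX.prod law) z) ∂law := by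
        simp only [StochasticCode.rate, rejectionCode, List.length_replicate, condEntropy,
          h_map_snd, Y]
    _ ≤ ∫⁻ z, ∑' k, firstHitProb PX A V k z * surprisal (firstHitProb PX A V k z) ∂law := by
        refine lintegral_mono_ae ?_
        filter_upwards [hV.ae_measure_forall_notMem_section (PX := PX) hA hA0,
          condDistrib_uncurry_snd_ae_eq PX law hY] with z h_hit h_cond
        have hK : Measurable fun x => firstHit (Prod.mk x ⁻¹' A) V z :=
          (measurable_firstHit_section hA hV.measurable).comp measurable_prodMk_right
        rw [h_cond]
        simpa only [measure_firstHit_eq_firstHitProb h_hit] using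
          entropy_map_le_tsum (PX := PX) hK fun k => g (V k z)
    _ ≤ a⁻¹ * ∫⁻ v, PX {x | (x, v) ∈ A} * surprisal (PX {x | (x, v) ∈ A}) ∂lam + bitsPerNat :=
        hV.lintegral_tsum_firstHitProb_mul_surprisal_le hA ha ha0

end RejectionCode

section UniformHeight

theorem cond_Ioc_ofReal_le {b : ℝ≥0} {c : ℝ≥0∞} (hc : c ≤ b) :
    volume[{u : ℝ | ENNReal.ofReal u ≤ c} | Set.Ioc (0 : ℝ) b] = (b : ℝ≥0∞)⁻¹ * c := by
  have h_meas : MeasurableSet {u : ℝ | ENNReal.ofReal u ≤ c} :=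
    measurableSet_le (by fun_prop) measurable_const
  have h_inter : Set.Ioc (0 : ℝ) b ∩ {u | ENNReal.ofReal u ≤ c} =
      {u | ENNReal.ofReal u ≤ c} ∩ Set.Ioi (0 : ℝ) := by
    ext u
    have hub (hu : ENNReal.ofReal u ≤ c) : u ≤ b := by
      simpa using ENNReal.ofReal_le_iff_le_toReal ENNReal.coe_ne_top |>.1 (hu.trans hc)
    exact ⟨fun h => ⟨h.2, h.1.1⟩, fun h => ⟨⟨h.2, hub h.1⟩, h.1⟩⟩
  rw [cond_apply measurableSet_Ioc, h_inter, ← Measure.restrict_apply h_meas,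
    volume_restrict_Ioi_ofReal_le, Real.volume_Ioc, sub_zero, ENNReal.ofReal_coe_nnreal]

variable {𝒳 : Type u} {𝒴 : Type v} [MeasurableSpace 𝒳] [MeasurableSpace 𝒴]

/-- The law of a proposal `(y, u)`: a point `y ∼ ν` with an independent height `u` uniform on
`(0, b]`. -/
noncomputable def proposalLaw (ν : Measure 𝒴) (b : ℝ≥0) : Measure (𝒴 × ℝ) :=
  ν.prod (volume[|Set.Ioc (0 : ℝ) b])

/-- The region under the graph of `r`, in which an input `x` accepts a proposal `(y, u)`. -/
def acceptSet (r : 𝒳 → 𝒴 → ℝ≥0∞) : Set (𝒳 × 𝒴 × ℝ) :=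
  {p | ENNReal.ofReal p.2.2 ≤ r p.1 p.2.1}

variable {ν : Measure 𝒴} {b : ℝ≥0} {r : 𝒳 → 𝒴 → ℝ≥0∞}

theorem isProbabilityMeasure_proposalLaw [IsProbabilityMeasure ν] (hb : b ≠ 0) :
    IsProbabilityMeasure (proposalLaw ν b) := by
  have : IsProbabilityMeasure (volume[|Set.Ioc (0 : ℝ) b]) :=
    cond_isProbabilityMeasure_of_finite (by simpa [pos_iff_ne_zero] using hb) (by simp)
  exact Measure.prod.instIsProbabilityMeasure ..

theorem lintegral_proposalLaw_le {g : 𝒴 × ℝ → ℝ≥0∞} (hg : Measurable g) :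
    ∫⁻ p, g p ∂(proposalLaw ν b) ≤
      (b : ℝ≥0∞)⁻¹ * ∫⁻ y, (∫⁻ u in Set.Ioi (0 : ℝ), g (y, u)) ∂ν := by
  rw [proposalLaw, lintegral_prod _ hg.aemeasurable, ← lintegral_const_mul _ (by fun_prop)]
  refine lintegral_mono fun y => ?_
  rw [ProbabilityTheory.cond, lintegral_smul_measure, Real.volume_Ioc, sub_zero,
    ENNReal.ofReal_coe_nnreal, smul_eq_mul]
  gcongr
  exact Set.Ioc_subset_Ioi_self

theorem measurableSet_acceptSet (hr : Measurable (Function.uncurry r)) :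
    MeasurableSet (acceptSet r) :=
  measurableSet_le (by fun_prop) (hr.comp (by fun_prop : Measurable fun p : 𝒳 × 𝒴 × ℝ =>
    (p.1, p.2.1)))

theorem proposalLaw_acceptSet_inter (hr : Measurable (Function.uncurry r))
    (hrb : ∀ x y, r x y ≤ b) (x : 𝒳) {s : Set 𝒴} (hs : MeasurableSet s) :
    proposalLaw ν b (Prod.mk x ⁻¹' acceptSet r ∩ Prod.fst ⁻¹' s) =
      (b : ℝ≥0∞)⁻¹ * ν.withDensity (r x) s := by
  have h_section : MeasurableSet (Prod.mk x ⁻¹' acceptSet r) :=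
    measurable_prodMk_left (measurableSet_acceptSet hr)
  rw [proposalLaw, Measure.prod_apply (h_section.inter (measurable_fst hs)),
    withDensity_apply _ hs, ← lintegral_const_mul _ hr.of_uncurry_left, ← lintegral_indicator hs]
  congr 1 with y
  by_cases hy : y ∈ s
  · simpa [hy, acceptSet, Set.preimage] using cond_Ioc_ofReal_le (hrb x y)
  · have h_empty : Prod.mk y ⁻¹' (Prod.fst ⁻¹' s) = (∅ : Set ℝ) := by
      ext u
      simp [hy]
    simp [hy, h_empty]

theorem proposalLaw_acceptSet (hr : Measurable (Function.uncurry r))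
    (hrb : ∀ x y, r x y ≤ b) (x : 𝒳) [IsProbabilityMeasure (ν.withDensity (r x))] :
    proposalLaw ν b (Prod.mk x ⁻¹' acceptSet r) = (b : ℝ≥0∞)⁻¹ := by
  simpa using proposalLaw_acceptSet_inter (ν := ν) hr hrb x .univ

theorem map_fst_cond_proposalLaw_acceptSet (hr : Measurable (Function.uncurry r))
    (hrb : ∀ x y, r x y ≤ b) (hb : b ≠ 0) (x : 𝒳) [IsProbabilityMeasure (ν.withDensity (r x))] :
    ((proposalLaw ν b)[|Prod.mk x ⁻¹' acceptSet r]).map Prod.fst = ν.withDensity (r x) := by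
  ext s hs
  rw [Measure.map_apply measurable_fst hs,
    cond_apply (measurable_prodMk_left (measurableSet_acceptSet hr)),
    proposalLaw_acceptSet hr hrb, proposalLaw_acceptSet_inter hr hrb x hs, inv_inv, ← mul_assoc,
    ENNReal.mul_inv_cancel (by simpa using hb) ENNReal.coe_ne_top, one_mul]

end UniformHeight

section ExistsIID

theorem standardBorelSpace_ulift (α : Type u) [MeasurableSpace α] [StandardBorelSpace α] :
    StandardBorelSpace (ULift.{w} α) := by
  let _ := upgradeStandardBorel α
  have : PolishSpace (ULift.{w} α) := Homeomorph.ulift.isClosedEmbedding.polishSpace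
  infer_instance

variable {E F 𝒵 𝒵' : Type*} [MeasurableSpace E] [MeasurableSpace F] [MeasurableSpace 𝒵]
  [MeasurableSpace 𝒵']

theorem isIIDSequence_infinitePi (lam : Measure E) [IsProbabilityMeasure lam] :
    IsIIDSequence (fun k z => z k) (Measure.infinitePi fun _ : ℕ => lam) lam where
  measurable := measurable_pi_apply
  iIndepFun := iIndepFun_infinitePi (X := fun _ => id) fun _ => measurable_id
  map_eq := Measure.infinitePi_map_eval _

theorem IsIIDSequence.comp {V : ℕ → 𝒵 → E} {law : Measure 𝒵} {lam : Measure E}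
    (hV : IsIIDSequence V law lam) {g : E → F} (hg : Measurable g) :
    IsIIDSequence (fun k => g ∘ V k) law (lam.map g) where
  measurable k := hg.comp (hV.measurable k)
  iIndepFun := hV.iIndepFun.comp (fun _ => g) fun _ => hg
  map_eq k := by rw [← Measure.map_map hg (hV.measurable k), hV.map_eq]

theorem IsIIDSequence.comp_measurePreserving {V : ℕ → 𝒵 → E} {law : Measure 𝒵} {lam : Measure E}
    (hV : IsIIDSequence V law lam) {law' : Measure 𝒵'} {φ : 𝒵' → 𝒵}
    (hφ : MeasurePreserving φ law' law) : IsIIDSequence (fun k => V k ∘ φ) law' lam where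
  measurable k := (hV.measurable k).comp hφ.measurable
  iIndepFun := by
    have := hV.iIndepFun.isProbabilityMeasure
    have : IsProbabilityMeasure law' :=
      ⟨by simpa using hφ.measure_preimage nullMeasurableSet_univ⟩
    have h_law := (iIndepFun_iff_map_fun_eq_infinitePi_map hV.measurable).1 hV.iIndepFun
    refine (iIndepFun_iff_map_fun_eq_infinitePi_map fun k =>
      (hV.measurable k).comp hφ.measurable).2 ?_
    simp only [← Measure.map_map (hV.measurable _) hφ.measurable, hφ.map_eq]
    rw [← h_law, ← hφ.map_eq, Measure.map_map (measurable_pi_lambda _ hV.measurable) hφ.measurable]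
    rfl
  map_eq k := by rw [← Measure.map_map (hV.measurable k) hφ.measurable, hφ.map_eq, hV.map_eq]

theorem exists_isIIDSequence_standardBorel [StandardBorelSpace E] (lam : Measure E)
    [IsProbabilityMeasure lam] :
    ∃ (𝒵 : Type w) (_ : MeasurableSpace 𝒵) (_ : StandardBorelSpace 𝒵) (law : Measure 𝒵)
      (V : ℕ → 𝒵 → E), IsIIDSequence V law lam := by
  have : Nonempty E := nonempty_of_isProbabilityMeasure lam
  have h_emb := measurableEmbedding_embeddingReal E
  have := Measure.isProbabilityMeasure_map (μ := lam) h_emb.measurable.aemeasurable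
  have h_inv : (lam.map (embeddingReal E)).map h_emb.invFun = lam := by
    rw [Measure.map_map h_emb.measurable_invFun h_emb.measurable,
      h_emb.leftInverse_invFun.comp_eq_id, Measure.map_id]
  have h_down : MeasurePreserving (ULift.down.{w} : ULift (ℕ → ℝ) → ℕ → ℝ)
      ((Measure.infinitePi fun _ : ℕ => lam.map (embeddingReal E)).map ULift.up)
      (Measure.infinitePi fun _ : ℕ => lam.map (embeddingReal E)) := by
    refine ⟨measurable_down, ?_⟩
    rw [Measure.map_map measurable_down measurable_up]
    exact Measure.map_id
  exact ⟨ULift.{w} (ℕ → ℝ), inferInstance, standardBorelSpace_ulift _, _, _,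
    h_inv ▸ ((isIIDSequence_infinitePi _).comp h_emb.measurable_invFun).comp_measurePreserving
      h_down⟩

end ExistsIID

theorem minCodeRate_le_functionalInformation_add {𝒳 : Type u} {𝒴 : Type v} [MeasurableSpace 𝒳]
    [StandardBorelSpace 𝒳] [Nonempty 𝒳] [MeasurableSpace 𝒴] [StandardBorelSpace 𝒴] [Nonempty 𝒴]
    {P : Measure (𝒳 × 𝒴)} [IsProbabilityMeasure P] {W : Kernel 𝒳 𝒴} [IsMarkovKernel W]
    {r : 𝒳 → 𝒴 → ℝ≥0∞} {b : ℝ≥0} (hr : Measurable (Function.uncurry r))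
    (hrb : ∀ x y, r x y ≤ b) (hW : ∀ x, W x = P.snd.withDensity (r x))
    (hP : P.fst ⊗ₘ W = P) :
    minCodeRate.{u, v, w} P.fst W ≤ functionalInformation P + bitsPerNat := by
  have hP_density : P = (P.fst.prod P.snd).withDensity (Function.uncurry r) :=
    hP.symm.trans (compProd_eq_prod_withDensity hr hW)
  have h_prob (x : 𝒳) : IsProbabilityMeasure (P.snd.withDensity (r x)) := hW x ▸ inferInstance
  have hb : b ≠ 0 := by
    rintro rfl
    obtain ⟨x⟩ := ‹Nonempty 𝒳›
    have h_one := (h_prob x).measure_univ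
    have h_zero : r x = 0 := funext fun y => le_antisymm (by simpa using hrb x y) zero_le
    simp [h_zero] at h_one
  have := isProbabilityMeasure_proposalLaw (ν := P.snd) hb
  obtain ⟨𝒵, _, _, law, V, hV⟩ := exists_isIIDSequence_standardBorel.{w} (proposalLaw P.snd b)
  have hA := measurableSet_acceptSet hr
  have h_mass (x : 𝒳) := proposalLaw_acceptSet (ν := P.snd) hr hrb x
  have h_width : Measurable fun v => P.fst {x | (x, v) ∈ acceptSet r} :=
    measurable_measure_prodMk_right hA
  let C : StochasticCode W 𝒵 := rejectionCode hA hV measurable_fst (fun x => by simp [h_mass])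
    fun x => (hW x).trans (map_fst_cond_proposalLaw_acceptSet hr hrb hb x).symm
  calc minCodeRate.{u, v, w} P.fst W
      ≤ C.rate P.fst := sInf_le ⟨𝒵, inferInstance, inferInstance, C, rfl⟩
    _ ≤ (b : ℝ≥0∞)⁻¹⁻¹ * ∫⁻ v, P.fst {x | (x, v) ∈ acceptSet r} *
          surprisal (P.fst {x | (x, v) ∈ acceptSet r}) ∂(proposalLaw P.snd b) + bitsPerNat :=
        rate_rejectionCode_le hA hV _ _ _ h_mass
    _ ≤ (b : ℝ≥0∞)⁻¹⁻¹ * ((b : ℝ≥0∞)⁻¹ * functionalInformation P) + bitsPerNat := by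
        rw [functionalInformation_eq_lintegral_width hr hP_density]
        gcongr
        exact lintegral_proposalLaw_le (h_width.mul (measurable_surprisal.comp h_width))
    _ = functionalInformation P + bitsPerNat := by
        rw [← mul_assoc, ENNReal.inv_mul_cancel (by simp) (by simpa using hb), one_mul]


theorem mainTheorem2 {𝒳 : Type u} {𝒴 : Type v}
    [MeasurableSpace 𝒳] [StandardBorelSpace 𝒳] [Nonempty 𝒳]
    [MeasurableSpace 𝒴] [StandardBorelSpace 𝒴] [Nonempty 𝒴]
    (P : Measure (𝒳 × 𝒴)) [IsProbabilityMeasure P]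
    (W : Kernel 𝒳 𝒴) [IsMarkovKernel W] (hW : P.fst.compProd W = P)
    (M : ℝ≥0)
    (hM : ∀ x, W x ≪ P.snd ∧ ∀ᵐ y ∂P.snd, (W x).rnDeriv P.snd y ≤ (M : ℝ≥0∞)) :
    functionalInformation P ≤ minRate.{u, v, w} P ∧
      minRate.{u, v, w} P ≤ minCodeRate.{u, v, w} P.fst W ∧
      minCodeRate.{u, v, w} P.fst W ≤
        functionalInformation P + ENNReal.ofReal (Real.logb 2 (Real.exp 1)) := by
  obtain ⟨r, hr, hrM, hWr⟩ := exists_bounded_density hM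
  have hP : P ≪ P.fst.prod P.snd := calc
    P = (P.fst.prod P.snd).withDensity (Function.uncurry r) :=
      hW.symm.trans (compProd_eq_prod_withDensity hr hWr)
    _ ≪ P.fst.prod P.snd := withDensity_absolutelyContinuous _ _
  refine ⟨functionalInformation_le_minRate hP, ?_,
    minCodeRate_le_functionalInformation_add hr hrM hWr hW⟩
  simpa only [hW] using minRate_le_minCodeRate (W := W) P.fst
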